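/- Let $(M,g_m)$ and $(N,g_n)$ be smooth Riemannian manifolds with $\dim M>\dim N$, with Levi-Civita connections $\nabla$ and $\nabla^N$. Let $(\varphi_*,\zeta,\eta_*,g_m)$ be a Sasakian structure on $M$: $\varphi_*$ is a smooth $(1,1)$-tensor field, $\zeta$ a smooth vector field and $\eta_*$ a $1$-form such that $$\varphi_*^2P=-P+\eta_*(P)\zeta,\quad \varphi_*\zeta=0,\quad \eta_*\circ\varphi_*=0,\quad \eta_*(\zeta)=1,\quad g_m(P,\zeta)=\eta_*(P),$$ $$g_m(\varphi_*P,\varphi_*Q)=g_m(P,Q)-\eta_*(P)\eta_*(Q),\qquad g_m(\varphi_*P,Q)=-g_m(P,\varphi_*Q),$$ $$(\nabla_P\varphi_*)Q=g_m(P,Q)\zeta-\eta_*(Q)P,\qquad \nabla_P\zeta=-\varphi_*P$$ for all vector fields $P,Q$. Let $\Psi:M\to N$ be a semi-invariant conformal $\zeta^\perp$-Riemannian submersion with dilation $\lambda_*:M\to(0,\infty)$. This means that $\Psi$ is a smooth surjective submersion with $g_n(\Psi_*P,\Psi_*Q)=\lambda_*^2\,g_m(P,Q)$ for all $P,Q\in(\ker\Psi_*)^\perp$;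 that $\zeta$ is orthogonal to $\ker\Psi_*$; and that there is a smooth distribution $D_1\subseteq\ker\Psi_*$ with $\varphi_*(D_1)=D_1$ and $\varphi_*(D_2)\subseteq(\ker\Psi_*)^\perp$, where $D_2$ is the orthogonal complement of $D_1$ in $\ker\Psi_*$. Let $\mu$ be the orthogonal complement of $\varphi_*D_2$ in $(\ker\Psi_*)^\perp$. Let $\mathcal V$ and $\mathcal H$ be the orthogonal projections of $TM$ onto $\ker\Psi_*$ and $(\ker\Psi_*)^\perp$. For $V\in\Gamma(\ker\Psi_*)$ write $\varphi_*V=\phi V+\omega V$ with $\phi V=\mathcal V\varphi_*V$ and $\omega V=\mathcal H\varphi_*V$; for $P\in\Gamma((\ker\Psi_*)^\perp)$ put $\beta P=\mathcal H\varphi_*P$. Let $$T_XY=\mathcal H\nabla_{\mathcal VX}\mathcal VY+\mathcal V\nabla_{\mathcal VX}\mathcal HY,\qquad A_XY=\mathcal H\nabla_{\mathcal HX}\mathcal VY+\mathcal V\nabla_{\mathcal HX}\mathcal HY,\qquad \hat\nabla_XY=\mathcal V\nabla_XY,$$ and let $\nabla^\Psi$ be the connection on the pullback bundle $\Psi^{-1}TN$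 induced by $\nabla^N$. Then $\ker\Psi_*$ defines a totally geodesic foliation of $M$ (that is, $\nabla_UV\in\Gamma(\ker\Psi_*)$ for all $U,V\in\Gamma(\ker\Psi_*)$) if and only if both of the following conditions hold: 1. for all $U,V\in\Gamma(\ker\Psi_*)$ and $Z\in\Gamma(\mu)$, $$g_n\big(\nabla^\Psi_{\omega V}\Psi_*Z,\Psi_*\omega U\big)=\lambda_*^2\,g_m\big(\beta T_U\phi V+A_{\omega V}\phi U+g_m(\omega V,\omega U)\,\mathrm{grad}\ln\lambda_*-g_m(\phi U,V)\,\zeta,\;Z\big);$$ 2. for all $U,V\in\Gamma(\ker\Psi_*)$, $\;T_U\omega V+\hat\nabla_U\phi V\in\Gamma(D_1)$. -/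

import Mathlib

open Bundle VectorField
open scoped Manifold ContDiff
noncomputable section
namespace SicSubmersion
variable {E : Type*} [NormedAddCommGroup E] [NormedSpace ℝ E]
  {H : Type*} [TopologicalSpace H] {I : ModelWithCorners ℝ E H}
  {M : Type*} [TopologicalSpace M] [ChartedSpace H M]

instance tangentSpace_finiteDimensional [FiniteDimensional ℝ E] (x : M) :
    FiniteDimensional ℝ (TangentSpace I x) :=
  inferInstanceAs (FiniteDimensional ℝ E)

instance tangentSpace_t2Space (x : M) : T2Space (TangentSpace I x) :=
  inferInstanceAs (T2Space E)

variable [IsManifold I ∞ M]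

/-- The fiberwise bilinear form of a Riemannian metric. -/
def metricForm (g : ContMDiffRiemannianMetric I ∞ E (fun x : M ↦ TangentSpace I x)) (x : M) :
    LinearMap.BilinForm ℝ (TangentSpace I x) :=
  LinearMap.mk₂ ℝ (fun v w ↦ g.inner x v w) (by simp) (by simp) (by simp) (by simp)

variable (g : ContMDiffRiemannianMetric I ∞ E (fun x : M ↦ TangentSpace I x))

theorem metricForm_isSymm (x : M) : (metricForm g x).IsSymm := ⟨fun v w ↦ g.symm x v w⟩

theorem metricForm_restrict_nondegenerate (x : M) (K : Submodule ℝ (TangentSpace I x)) :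
    ((metricForm g x).restrict K).Nondegenerate := by
  have key : ∀ v : K, g.inner x (v : TangentSpace I x) v = 0 → v = 0 := by
    intro v hv
    by_contra hne
    exact (g.pos x v (fun h ↦ hne (Subtype.ext h))).ne' hv
  exact ⟨fun v hv ↦ key v (hv v), fun v hv ↦ key v (hv v)⟩

theorem metricForm_nondegenerate (x : M) : (metricForm g x).Nondegenerate := by
  have key : ∀ v : TangentSpace I x, g.inner x v v = 0 → v = 0 := by
    intro v hv
    by_contra hne
    exact (g.pos x v hne).ne' hv
  exact ⟨fun v hv ↦ key v (hv v), fun v hv ↦ key v (hv v)⟩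

theorem metric_ext {x : M} {u v : TangentSpace I x}
    (h : ∀ w, g.inner x u w = g.inner x v w) : u = v := by
  have := (metricForm_nondegenerate g x).1 (u - v) (fun w ↦ by
    change g.inner x (u - v) w = 0
    simp [h w])
  exact sub_eq_zero.mp this

variable {x : M}

theorem mdiff_metric {Y Z : Π x : M, TangentSpace I x} (hY : MDiffAt (T% Y) x)
    (hZ : MDiffAt (T% Z) x) : MDiffAt (fun y ↦ g.inner y (Y y) (Z y)) x := by
  have : MDifferentiableAt I (I.prod 𝓘(ℝ))
      (fun m ↦ TotalSpace.mk' ℝ (E := Bundle.Trivial M ℝ) m (g.inner m (Y m) (Z m))) x := by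
    apply MDifferentiableAt.clm_bundle_apply₂ (F₁ := E) (F₂ := E)
    · exact (g.contMDiff.mdifferentiable (by simp)) x
    · exact hY
    · exact hZ
  simp only [mdifferentiableAt_totalSpace] at this
  exact this.2

theorem mdiff_extend (v : TangentSpace I x) :
    MDiffAt (T% (FiberBundle.extend E v : Π y : M, TangentSpace I y)) x :=
  FiberBundle.mdifferentiableAt_extend ..

/-- The right-hand side of Koszul's formula. -/
def koszul (X Y Z : Π x : M, TangentSpace I x) (x : M) : ℝ :=
  (1 / 2) * (d% (fun y ↦ g.inner y (Y y) (Z y)) x (X x)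
    + d% (fun y ↦ g.inner y (X y) (Z y)) x (Y x)
    - d% (fun y ↦ g.inner y (X y) (Y y)) x (Z x)
    + g.inner x (mlieBracket I X Y x) (Z x)
    - g.inner x (mlieBracket I X Z x) (Y x)
    - g.inner x (mlieBracket I Y Z x) (X x))

variable [FiniteDimensional ℝ E]

theorem koszul_tensorial_right {X Y : Π x : M, TangentSpace I x} (hX : MDiffAt (T% X) x)
    (hY : MDiffAt (T% Y) x) : TensorialAt I E (koszul g X Y · x) x where
  smul {f σ} hf hσ := by
    have h1 := mvfderiv_fun_mul hf (mdiff_metric g hY hσ)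
    have h2 := mvfderiv_fun_mul hf (mdiff_metric g hX hσ)
    simp [koszul, mlieBracket_smul_right hf hσ, h1, h2]
    rw [g.symm x (σ x) (Y x), g.symm x (σ x) (X x)]
    ring
  add {σ σ'} hσ hσ' := by
    have h1 := mvfderiv_fun_add (mdiff_metric g hY hσ) (mdiff_metric g hY hσ')
    have h2 := mvfderiv_fun_add (mdiff_metric g hX hσ) (mdiff_metric g hX hσ')
    simp [koszul, mlieBracket_add_right hσ hσ', h1, h2]
    ring

theorem koszul_tensorial_left {Y Z : Π x : M, TangentSpace I x} (hY : MDiffAt (T% Y) x)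
    (hZ : MDiffAt (T% Z) x) : TensorialAt I E (koszul g · Y Z x) x where
  smul {f σ} hf hσ := by
    have h1 := mvfderiv_fun_mul hf (mdiff_metric g hσ hZ)
    have h2 := mvfderiv_fun_mul hf (mdiff_metric g hσ hY)
    simp [koszul, mlieBracket_smul_left hf hσ, h1, h2]
    rw [g.symm x (mlieBracket I Y Z x)]
    ring
  add {σ σ'} hσ hσ' := by
    have h1 := mvfderiv_fun_add (mdiff_metric g hσ hZ) (mdiff_metric g hσ' hZ)
    have h2 := mvfderiv_fun_add (mdiff_metric g hσ hY) (mdiff_metric g hσ' hY)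
    simp [koszul, mlieBracket_add_left hσ hσ', h1, h2]
    ring

/-- The musical isomorphism `♯`, from covectors to vectors. -/
def sharp (x : M) : Module.Dual ℝ (TangentSpace I x) →ₗ[ℝ] TangentSpace I x :=
  ((metricForm g x).toDual (metricForm_nondegenerate g x)).symm.toLinearMap

theorem inner_sharp (x : M) (l : Module.Dual ℝ (TangentSpace I x)) (w : TangentSpace I x) :
    g.inner x (sharp g x l) w = l w :=
  (metricForm g x).apply_toDual_symm_apply l w

open Classical in
/-- The map underlying the Levi-Civita connection: for a field `Y` differentiable at `x`,
`leviCivitaFun g Y x v` is the vector whose inner product with `w` is Koszul's expression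
for any differentiable extensions of `v` and `w`. -/
def leviCivitaFun (Y : Π x : M, TangentSpace I x) (x : M) :
    TangentSpace I x →L[ℝ] TangentSpace I x :=
  if hY : MDiffAt (T% Y) x then
    LinearMap.toContinuousLinearMap
      (sharp g x ∘ₗ ContinuousLinearMap.coeLM ℝ ∘ₗ
        (TensorialAt.mkHom₂ (fun X Z ↦ koszul g X Y Z x) x
          (fun _ hZ ↦ koszul_tensorial_left g hY hZ)
          (fun _ hX ↦ koszul_tensorial_right g hX hY)).toLinearMap)
  else 0

/-- Koszul's formula. -/
theorem inner_leviCivitaFun {X Y Z : Π x : M, TangentSpace I x} (hX : MDiffAt (T% X) x)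
    (hY : MDiffAt (T% Y) x) (hZ : MDiffAt (T% Z) x) :
    g.inner x (leviCivitaFun g Y x (X x)) (Z x) = koszul g X Y Z x := by
  simp only [leviCivitaFun, hY, dif_pos]
  refine (inner_sharp g x _ _).trans ?_
  exact TensorialAt.mkHom₂_apply (Φ := fun X Z ↦ koszul g X Y Z x)
    (fun _ hZ ↦ koszul_tensorial_left g hY hZ) (fun _ hX ↦ koszul_tensorial_right g hX hY) hX hZ

theorem leviCivitaFun_ext {Y : Π x : M, TangentSpace I x} (hY : MDiffAt (T% Y) x)
    {L : TangentSpace I x →L[ℝ] TangentSpace I x}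
    (h : ∀ X Z : Π x : M, TangentSpace I x, MDiffAt (T% X) x → MDiffAt (T% Z) x →
      koszul g X Y Z x = g.inner x (L (X x)) (Z x)) : leviCivitaFun g Y x = L := by
  ext v
  refine metric_ext g fun w ↦ ?_
  have h1 := inner_leviCivitaFun g (mdiff_extend v) hY (mdiff_extend w)
  rw [h _ _ (mdiff_extend v) (mdiff_extend w)] at h1
  simpa using h1

theorem isCovariantDerivativeOn_leviCivitaFun :
    IsCovariantDerivativeOn E (leviCivitaFun g) Set.univ where
  add {Y Y' x} hY hY' _ := by
    refine leviCivitaFun_ext g (mdifferentiableAt_add_section hY hY') fun X Z hX hZ ↦ ?_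
    have h1 := mvfderiv_fun_add (mdiff_metric g hY hZ) (mdiff_metric g hY' hZ)
    have h2 := mvfderiv_fun_add (mdiff_metric g hX hY) (mdiff_metric g hX hY')
    simp only [add_apply, map_add, inner_leviCivitaFun g hX hY hZ,
      inner_leviCivitaFun g hX hY' hZ]
    simp [koszul, mlieBracket_add_right hY hY', mlieBracket_add_left hY hY', h1, h2]
    ring
  leibniz {Y f x} hY hf _ := by
    refine leviCivitaFun_ext g (hf.smul_section hY) fun X Z hX hZ ↦ ?_
    have h1 := mvfderiv_fun_mul hf (mdiff_metric g hY hZ)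
    have h2 := mvfderiv_fun_mul hf (mdiff_metric g hX hY)
    simp only [add_apply, map_add, smul_apply, map_smul,
      inner_leviCivitaFun g hX hY hZ, ContinuousLinearMap.smulRight_apply, smul_eq_mul]
    simp [koszul, mlieBracket_smul_right hf hY, mlieBracket_smul_left hf hY, h1, h2]
    rw [g.symm x (Y x) (X x)]
    ring

/-- The Levi-Civita connection of a Riemannian metric, given by Koszul's formula.
`leviCivita g Y x (X x)` is `(∇_X Y)(x)`. -/
def leviCivita : CovariantDerivative I E (TangentSpace I : M → Type _) :=
  ⟨leviCivitaFun g, isCovariantDerivativeOn_leviCivitaFun g⟩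

/-- The connection is torsion free. -/
theorem leviCivita_torsion : (leviCivita g).torsion = 0 := by
  rw [CovariantDerivative.torsion_eq_zero_iff]
  intro X Y x hX hY
  refine metric_ext g fun w ↦ ?_
  have h1 := inner_leviCivitaFun g hX hY (mdiff_extend w)
  have h2 := inner_leviCivitaFun g hY hX (mdiff_extend w)
  simp only [FiberBundle.extend_apply_self] at h1 h2
  change g.inner x (leviCivitaFun g Y x (X x) - leviCivitaFun g X x (Y x)) w = _
  simp only [map_sub, sub_apply, h1, h2, koszul]
  have e : (fun y ↦ g.inner y (X y) (Y y)) = fun y ↦ g.inner y (Y y) (X y) :=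
    funext fun y ↦ g.symm y _ _
  rw [e, mlieBracket_swap_apply (V := Y) (W := X)]
  simp
  ring

/-- The connection is compatible with the metric. -/
theorem leviCivita_metric {X Y Z : Π x : M, TangentSpace I x} (hX : MDiffAt (T% X) x)
    (hY : MDiffAt (T% Y) x) (hZ : MDiffAt (T% Z) x) :
    d% (fun y ↦ g.inner y (Y y) (Z y)) x (X x) =
      g.inner x (leviCivita g Y x (X x)) (Z x) + g.inner x (Y x) (leviCivita g Z x (X x)) := by
  have h1 := inner_leviCivitaFun g hX hY hZ
  have h2 := inner_leviCivitaFun g hX hZ hY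
  rw [g.symm x (Y x)]
  change _ = g.inner x (leviCivitaFun g Y x (X x)) (Z x) +
    g.inner x (leviCivitaFun g Z x (X x)) (Y x)
  rw [h1, h2, koszul, koszul]
  have e : (fun y ↦ g.inner y (Z y) (Y y)) = fun y ↦ g.inner y (Y y) (Z y) :=
    funext fun y ↦ g.symm y _ _
  rw [e, mlieBracket_swap_apply (V := Z) (W := Y)]
  simp
  ring

/-- The vector field `∇_X Y`. -/
def nabla (X Y : Π x : M, TangentSpace I x) (x : M) : TangentSpace I x :=
  leviCivita g Y x (X x)

/-- The gradient of a real function. -/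
def grad (f : M → ℝ) (x : M) : TangentSpace I x :=
  sharp g x (d% f x).toLinearMap

/-- The orthogonal complement of a subspace of a tangent space. -/
def orth (x : M) (K : Submodule ℝ (TangentSpace I x)) : Submodule ℝ (TangentSpace I x) :=
  (metricForm g x).orthogonal K

theorem isCompl_orth (x : M) (K : Submodule ℝ (TangentSpace I x)) : IsCompl K (orth g x K) :=
  LinearMap.BilinForm.isCompl_orthogonal_of_restrict_nondegenerate
    (metricForm_isSymm g x).isRefl (metricForm_restrict_nondegenerate g x K)

/-- A smooth distribution: a family of subspaces of the tangent spaces having, near every point,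
a frame of smooth vector fields. -/
def IsSmoothDistribution (D : Π x : M, Submodule ℝ (TangentSpace I x)) : Prop :=
  ∀ x : M, ∃ (k : ℕ) (s : Fin k → Π y : M, TangentSpace I y), ∃ u ∈ nhds x,
    (∀ i, ContMDiffOn I I.tangent ∞ (T% (s i)) u) ∧
    ∀ y ∈ u, LinearIndependent ℝ (fun i ↦ s i y) ∧
      Submodule.span ℝ (Set.range fun i ↦ s i y) = D y

/-- A smooth section of a distribution. -/
def IsSection (D : Π x : M, Submodule ℝ (TangentSpace I x)) (X : Π x : M, TangentSpace I x) :
    Prop :=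
  ContMDiff I I.tangent ∞ (T% X) ∧ ∀ x, X x ∈ D x

/-- An almost contact metric structure `(φ, ζ, η)` on the Riemannian manifold `(M, g)`.
The `1`-form `η` is smooth because it is dual to `ζ`. -/
structure AlmostContactMetricStructure where
  φ : Π x : M, TangentSpace I x →L[ℝ] TangentSpace I x
  ζ : Π x : M, TangentSpace I x
  η : Π x : M, TangentSpace I x →L[ℝ] ℝ
  contMDiff_φ : ContMDiff I (I.prod 𝓘(ℝ, E →L[ℝ] E)) ∞
    (fun x ↦ TotalSpace.mk' (E →L[ℝ] E)
      (E := fun x : M ↦ TangentSpace I x →L[ℝ] TangentSpace I x) x (φ x))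
  contMDiff_ζ : ContMDiff I I.tangent ∞ (T% ζ)
  φ_φ : ∀ x v, φ x (φ x v) = -v + η x v • ζ x
  φ_ζ : ∀ x, φ x (ζ x) = 0
  η_φ : ∀ x v, η x (φ x v) = 0
  η_ζ : ∀ x, η x (ζ x) = 1
  inner_ζ : ∀ x v, g.inner x v (ζ x) = η x v
  inner_φ_φ : ∀ x v w, g.inner x (φ x v) (φ x w) = g.inner x v w - η x v * η x w
  inner_φ : ∀ x v w, g.inner x (φ x v) w = -g.inner x v (φ x w)

variable {g} in
/-- The Sasakian condition: `(∇_P φ) Q = g(P, Q) ζ - η(Q) P` and `∇_P ζ = -φ P`. -/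
structure AlmostContactMetricStructure.IsSasakian (S : AlmostContactMetricStructure g) : Prop where
  nabla_φ : ∀ P Q : Π x : M, TangentSpace I x,
    ContMDiff I I.tangent ∞ (T% P) → ContMDiff I I.tangent ∞ (T% Q) → ∀ x,
      nabla g P (fun y ↦ S.φ y (Q y)) x - S.φ x (nabla g P Q x)
        = g.inner x (P x) (Q x) • S.ζ x - S.η x (Q x) • P x
  nabla_ζ : ∀ P : Π x : M, TangentSpace I x, ContMDiff I I.tangent ∞ (T% P) → ∀ x,
    nabla g P S.ζ x = -S.φ x (P x)

section Submersion

variable {E' : Type*} [NormedAddCommGroup E'] [NormedSpace ℝ E']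
  {H' : Type*} [TopologicalSpace H'] {J : ModelWithCorners ℝ E' H'}
  {N : Type*} [TopologicalSpace N] [ChartedSpace H' N]

variable (I J) in
/-- The vertical distribution `ker Ψ_*`. -/
def vert (Ψ : M → N) (x : M) : Submodule ℝ (TangentSpace I x) :=
  (mfderiv I J Ψ x).toLinearMap.ker

variable (J) in
/-- The horizontal distribution `(ker Ψ_*)^⊥`. -/
def hor (Ψ : M → N) (x : M) : Submodule ℝ (TangentSpace I x) :=
  orth g x (vert I J Ψ x)

variable (J) in
/-- The orthogonal projection onto `ker Ψ_*`. -/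
def vProj (Ψ : M → N) (x : M) : TangentSpace I x →ₗ[ℝ] TangentSpace I x :=
  Submodule.projection _ _ (isCompl_orth g x (vert I J Ψ x))

variable (J) in
/-- The orthogonal projection onto `(ker Ψ_*)^⊥`. -/
def hProj (Ψ : M → N) (x : M) : TangentSpace I x →ₗ[ℝ] TangentSpace I x :=
  Submodule.projection _ _ (isCompl_orth g x (vert I J Ψ x)).symm

variable (J) in
/-- O'Neill's tensor `T_X Y = 𝓗 ∇_{𝓥X} 𝓥Y + 𝓥 ∇_{𝓥X} 𝓗Y`. -/
def oneillT (Ψ : M → N) (X Y : Π x : M, TangentSpace I x) (x : M) : TangentSpace I x :=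
  hProj g J Ψ x (nabla g (fun y ↦ vProj g J Ψ y (X y)) (fun y ↦ vProj g J Ψ y (Y y)) x)
    + vProj g J Ψ x (nabla g (fun y ↦ vProj g J Ψ y (X y)) (fun y ↦ hProj g J Ψ y (Y y)) x)

variable (J) in
/-- O'Neill's tensor `A_X Y = 𝓗 ∇_{𝓗X} 𝓥Y + 𝓥 ∇_{𝓗X} 𝓗Y`. -/
def oneillA (Ψ : M → N) (X Y : Π x : M, TangentSpace I x) (x : M) : TangentSpace I x :=
  hProj g J Ψ x (nabla g (fun y ↦ hProj g J Ψ y (X y)) (fun y ↦ vProj g J Ψ y (Y y)) x)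
    + vProj g J Ψ x (nabla g (fun y ↦ hProj g J Ψ y (X y)) (fun y ↦ hProj g J Ψ y (Y y)) x)

variable (J) in
/-- The induced connection on the fibers, `∇̂_X Y = 𝓥 ∇_X Y`. -/
def nablaHat (Ψ : M → N) (X Y : Π x : M, TangentSpace I x) (x : M) : TangentSpace I x :=
  vProj g J Ψ x (nabla g X Y x)

variable (J) in
/-- `ker Ψ_*` defines a totally geodesic foliation: `∇_U V` is vertical for all vertical
`U` and `V`. -/
def IsVertTotallyGeodesic (Ψ : M → N) : Prop :=
  ∀ U V : Π x : M, TangentSpace I x, IsSection (vert I J Ψ) U → IsSection (vert I J Ψ) V →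
    ∀ x, nabla g U V x ∈ vert I J Ψ x

section Structure

variable {g} (S : AlmostContactMetricStructure g)

variable (J) in
/-- The vertical part of `φ X`; on vertical `X` this is `ϕ X`, on horizontal `X` it is `α X`. -/
def vertPart (Ψ : M → N) (X : Π x : M, TangentSpace I x) (x : M) : TangentSpace I x :=
  vProj g J Ψ x (S.φ x (X x))

variable (J) in
/-- The horizontal part of `φ X`; on vertical `X` this is `ω X`, on horizontal `X` it is `β X`. -/
def horPart (Ψ : M → N) (X : Π x : M, TangentSpace I x) (x : M) : TangentSpace I x :=
  hProj g J Ψ x (S.φ x (X x))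

variable (g J) in
/-- The orthogonal complement `D₂` of `D₁` in `ker Ψ_*`. -/
def distD₂ (Ψ : M → N) (D₁ : Π x : M, Submodule ℝ (TangentSpace I x)) (x : M) :
    Submodule ℝ (TangentSpace I x) :=
  vert I J Ψ x ⊓ orth g x (D₁ x)

variable (J) in
/-- The orthogonal complement `μ` of `φ D₂` in `(ker Ψ_*)^⊥`. -/
def distMu (Ψ : M → N) (D₁ : Π x : M, Submodule ℝ (TangentSpace I x)) (x : M) :
    Submodule ℝ (TangentSpace I x) :=
  hor g J Ψ x ⊓ orth g x ((distD₂ g J Ψ D₁ x).map (S.φ x).toLinearMap)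

end Structure

variable [IsManifold J ∞ N]
  (h : ContMDiffRiemannianMetric J ∞ E' (fun y : N ↦ TangentSpace J y))

/-- A horizontally conformal submersion `Ψ : (M, g) → (N, h)` with dilation `lam`. -/
structure IsConformalSubmersion (Ψ : M → N) (lam : M → ℝ) : Prop where
  finrank_lt : Module.finrank ℝ E' < Module.finrank ℝ E
  contMDiff : ContMDiff I J ∞ Ψ
  surjective : Function.Surjective Ψ
  surjective_mfderiv : ∀ x, Function.Surjective (mfderiv I J Ψ x)
  lam_pos : ∀ x, 0 < lam x
  conformal : ∀ x, ∀ u ∈ hor g J Ψ x, ∀ v ∈ hor g J Ψ x,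
    h.inner (Ψ x) (mfderiv I J Ψ x u) (mfderiv I J Ψ x v) = lam x ^ 2 * g.inner x u v

variable {g} in
/-- A semi-invariant conformal `ζ^⊥`-Riemannian submersion with dilation `lam` and
invariant distribution `D₁`. -/
structure IsSicSubmersion (S : AlmostContactMetricStructure g) (Ψ : M → N) (lam : M → ℝ)
    (D₁ : Π x : M, Submodule ℝ (TangentSpace I x)) : Prop
    extends IsConformalSubmersion g h Ψ lam where
  ζ_mem : ∀ x, S.ζ x ∈ hor g J Ψ x
  smooth_D₁ : IsSmoothDistribution D₁
  D₁_le : ∀ x, D₁ x ≤ vert I J Ψ x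
  map_D₁ : ∀ x, (D₁ x).map (S.φ x).toLinearMap = D₁ x
  map_D₂ : ∀ x, (distD₂ g J Ψ D₁ x).map (S.φ x).toLinearMap ≤ hor g J Ψ x

variable [FiniteDimensional ℝ E'] in
/-- The connection induced on the pullback bundle `Ψ⁻¹TN` by the Levi-Civita connection of `(N, h)`.
A section `σ` of `Ψ⁻¹TN` near `x` is written `σ = ∑ i, c i • (e i ∘ Ψ)` in the frame `e` of `TN`
given by the trivialization at `Ψ x`, and `∇_v σ = ∑ i, (d(c i) v • e i + c i • ∇_{Ψ_* v} (e i))`.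
The second summand is `∇_{Ψ_* v}` of the field with constant coefficients `c i x` in this frame. -/
def pullbackNabla (Ψ : M → N) (σ : Π x : M, TangentSpace J (Ψ x)) (x : M) :
    TangentSpace I x →L[ℝ] TangentSpace J (Ψ x) :=
  letI t := trivializationAt E' (TangentSpace J : N → Type _) (Ψ x)
  (t.symmL ℝ (Ψ x)) ∘L (d% (fun y : M ↦ (t ⟨Ψ y, σ y⟩).2) x)
    + (leviCivita h (FiberBundle.extend E' (σ x)) (Ψ x)) ∘L (mfderiv I J Ψ x)

end Submersion

end SicSubmersion

end

open SicSubmersion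

/-!
Taking `Z = ζ` on either side of the equivalence forces `D₁ = 0`, because
`g(∇_X V, ζ) = -g(φ V, X)` for every vertical field `V`. So `φ` maps `ker Ψ_*` into its orthogonal
complement, and since `(∇_U φ) V` is a multiple of `ζ`, condition 2 says that `φ ∇_U V` is
horizontal. A Koszul formula for conformal submersions removes the dilation from condition 1 and
turns it into `g(∇_{φ V} Z, φ U) = 0`.

The key identity is `g(∇_{φ V} Z, φ U) = -g(∇_U V, Z)` for `Z` in `μ`. The flow of a vertical field
`U` rescales the horizontal metric, and by a factor `1` because of its effect on the unit field `ζ`,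
so `L_U g` vanishes on horizontal vectors. As `ζ` is a Killing field and `[ζ, U] - 2 φ U` is
vertical, differentiating along `ζ` yields `(L_{φ U} g)(Z, φ V) = (L_U g)(Z, V)`, from which the
identity follows. Conditions 1 and 2 then say that the horizontal part of `∇_U V` lies in `μ` and is
orthogonal to `μ`.
-/

noncomputable section

namespace SicSubmersion

section Charts

variable {E : Type*} [NormedAddCommGroup E] [NormedSpace ℝ E]
  {M : Type*} [TopologicalSpace M] [ChartedSpace E M]
  {F : Type*} [NormedAddCommGroup F] [NormedSpace ℝ F]

/-- The representative of a vector field in the preferred chart at `x`, as a field on the model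
space. -/
def chartField (X : Π x : M, TangentSpace 𝓘(ℝ, E) x) (x : M) (z : E) : E :=
  mpullback 𝓘(ℝ, E) 𝓘(ℝ, E) (extChartAt 𝓘(ℝ, E) x).symm X z

theorem contDiffAt_comp_extChartAt_symm {n : WithTop ℕ∞} [IsManifold 𝓘(ℝ, E) n M] {f : M → F}
    {x : M} (hf : CMDiffAt n f x) :
    ContDiffAt ℝ n (f ∘ (extChartAt 𝓘(ℝ, E) x).symm) (extChartAt 𝓘(ℝ, E) x x) := by
  rw [← contMDiffAt_iff_contDiffAt]
  have hsymm := contMDiffWithinAt_extChartAt_symm_range (I := 𝓘(ℝ, E)) (n := n) x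
    (mem_extChartAt_target x)
  rw [modelWithCornersSelf_coe, Set.range_id, contMDiffWithinAt_univ] at hsymm
  exact ContMDiffAt.comp _ (by rwa [extChartAt_to_inv]) hsymm

theorem mdifferentiableAt_of_comp_extChartAt_symm {k : M → F} {x : M}
    (hk : DifferentiableAt ℝ (k ∘ (extChartAt 𝓘(ℝ, E) x).symm) (extChartAt 𝓘(ℝ, E) x x)) :
    MDiffAt k x := by
  have hcomp := hk.mdifferentiableAt.comp x
    ((contMDiffAt_extChartAt (I := 𝓘(ℝ, E)) (n := 1)).mdifferentiableAt (by simp))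
  refine hcomp.congr_of_eventuallyEq ?_
  filter_upwards [extChartAt_source_mem_nhds (I := 𝓘(ℝ, E)) x] with y hy
  exact congrArg k ((extChartAt 𝓘(ℝ, E) x).left_inv hy).symm

section

variable [IsManifold 𝓘(ℝ, E) 1 M]

theorem isInvertible_mfderiv_extChartAt_symm {x : M} {z : E}
    (hz : z ∈ (extChartAt 𝓘(ℝ, E) x).target) :
    (mfderiv 𝓘(ℝ, E) 𝓘(ℝ, E) (extChartAt 𝓘(ℝ, E) x).symm z).IsInvertible := by
  have := isInvertible_mfderivWithin_extChartAt_symm (I := 𝓘(ℝ, E)) hz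
  rwa [modelWithCornersSelf_coe, Set.range_id, mfderivWithin_univ] at this

theorem fderiv_comp_extChartAt_symm {k : M → F} {x : M} {z : E}
    (hz : z ∈ (extChartAt 𝓘(ℝ, E) x).target)
    (hk : MDiffAt k ((extChartAt 𝓘(ℝ, E) x).symm z))
    (X : Π x : M, TangentSpace 𝓘(ℝ, E) x) :
    fderiv ℝ (k ∘ (extChartAt 𝓘(ℝ, E) x).symm) z (chartField X x z)
      = d% k ((extChartAt 𝓘(ℝ, E) x).symm z) (X ((extChartAt 𝓘(ℝ, E) x).symm z)) := by
  have hsymm : MDiffAt (extChartAt 𝓘(ℝ, E) x).symm z := by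
    have := mdifferentiableWithinAt_extChartAt_symm (I := 𝓘(ℝ, E)) hz
    rwa [modelWithCornersSelf_coe, Set.range_id, mdifferentiableWithinAt_univ] at this
  rw [← mfderiv_eq_fderiv, mfderiv_comp z hk hsymm, chartField, mpullback_apply]
  change (mfderiv 𝓘(ℝ, E) 𝓘(ℝ, F) k _) ((mfderiv 𝓘(ℝ, E) 𝓘(ℝ, E) _ z) _) = _
  rw [(isInvertible_mfderiv_extChartAt_symm hz).self_apply_inverse]
  rfl

theorem mfderiv_extChartAt_apply (X : Π x : M, TangentSpace 𝓘(ℝ, E) x) (x : M) :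
    mfderiv 𝓘(ℝ, E) 𝓘(ℝ, E) (extChartAt 𝓘(ℝ, E) x) x (X x)
      = chartField X x (extChartAt 𝓘(ℝ, E) x x) := by
  have hX := fderiv_comp_extChartAt_symm (k := extChartAt 𝓘(ℝ, E) x) (x := x)
    (mem_extChartAt_target x) (by
      rw [extChartAt_to_inv]; exact (contMDiffAt_extChartAt (n := 1)).mdifferentiableAt (by simp)) X
  have hid : (extChartAt 𝓘(ℝ, E) x ∘ (extChartAt 𝓘(ℝ, E) x).symm)
      =ᶠ[nhds (extChartAt 𝓘(ℝ, E) x x)] id := by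
    filter_upwards [extChartAt_target_mem_nhds (I := 𝓘(ℝ, E)) x] with z hz
    exact (extChartAt 𝓘(ℝ, E) x).right_inv hz
  rw [hid.fderiv_eq, fderiv_id, extChartAt_to_inv] at hX
  exact hX.symm

theorem mvfderiv_eq_fderiv_chart {k : M → F} {x : M} (hk : MDiffAt k x)
    (X : Π x : M, TangentSpace 𝓘(ℝ, E) x) :
    d% k x (X x) = fderiv ℝ (k ∘ (extChartAt 𝓘(ℝ, E) x).symm) (extChartAt 𝓘(ℝ, E) x x)
      (chartField X x (extChartAt 𝓘(ℝ, E) x x)) := by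
  rw [fderiv_comp_extChartAt_symm (mem_extChartAt_target x) (by rwa [extChartAt_to_inv]),
    extChartAt_to_inv]

end

section

variable [IsManifold 𝓘(ℝ, E) 2 M]

theorem fderiv_comp_extChartAt_symm_eventuallyEq {f : M → F} {x : M} (hf : CMDiffAt 2 f x)
    (X : Π x : M, TangentSpace 𝓘(ℝ, E) x) :
    (fun z ↦ fderiv ℝ (f ∘ (extChartAt 𝓘(ℝ, E) x).symm) z (chartField X x z))
      =ᶠ[nhds (extChartAt 𝓘(ℝ, E) x x)]
    ((fun y ↦ d% f y (X y)) ∘ (extChartAt 𝓘(ℝ, E) x).symm) := by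
  have hf_near : ∀ᶠ y in nhds x, MDiffAt f y :=
    ((contMDiffAt_iff_contMDiffAt_nhds (by simp)).1 hf).mono
      fun y hy ↦ hy.mdifferentiableAt (by simp)
  have hf_chart := (continuousAt_extChartAt_symm (I := 𝓘(ℝ, E)) x).eventually
    (p := fun y ↦ MDiffAt f y) (by simpa using hf_near)
  filter_upwards [hf_chart, extChartAt_target_mem_nhds (I := 𝓘(ℝ, E)) x] with z hfz hz
  exact fderiv_comp_extChartAt_symm hz hfz X

theorem chartField_mlieBracket (X Y : Π x : M, TangentSpace 𝓘(ℝ, E) x) (x : M) :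
    chartField (mlieBracket 𝓘(ℝ, E) X Y) x (extChartAt 𝓘(ℝ, E) x x) =
      lieBracket ℝ (chartField X x) (chartField Y x) (extChartAt 𝓘(ℝ, E) x x) := by
  have hinv : (mfderiv 𝓘(ℝ, E) 𝓘(ℝ, E) (extChartAt 𝓘(ℝ, E) x) x).IsInvertible :=
    isInvertible_mfderiv_extChartAt (mem_extChartAt_source x)
  rw [← mfderiv_extChartAt_apply, ← mlieBracketWithin_univ, mlieBracketWithin_apply]
  refine (hinv.self_apply_inverse _).trans ?_
  simp only [modelWithCornersSelf_coe, Set.range_id, mpullbackWithin_univ, Set.preimage_univ,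
    Set.inter_univ]
  exact congrFun (lieBracketWithin_univ (V := chartField X x) (W := chartField Y x)) _

variable [CompleteSpace E]

theorem differentiableAt_chartField {X : Π x : M, TangentSpace 𝓘(ℝ, E) x} {x : M}
    (hX : MDiffAt (T% X) x) : DifferentiableAt ℝ (chartField X x) (extChartAt 𝓘(ℝ, E) x x) := by
  rw [← mdifferentiableWithinAt_univ] at hX
  have := hX.differentiableWithinAt_mpullbackWithin_vectorField
  simp only [modelWithCornersSelf_coe, Set.range_id, mpullbackWithin_univ, Set.preimage_univ,
    Set.inter_univ] at this
  exact differentiableWithinAt_univ.1 this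

theorem mdifferentiableAt_mvfderiv_apply {f : M → F} {x : M} (hf : CMDiffAt 2 f x)
    {X : Π x : M, TangentSpace 𝓘(ℝ, E) x} (hX : MDiffAt (T% X) x) :
    MDiffAt (fun y ↦ d% f y (X y)) x := by
  apply mdifferentiableAt_of_comp_extChartAt_symm
  refine DifferentiableAt.congr_of_eventuallyEq ?_
    (fderiv_comp_extChartAt_symm_eventuallyEq hf X).symm
  exact (((contDiffAt_comp_extChartAt_symm hf).fderiv_right (m := 1) (by norm_num)).differentiableAt
    (by simp)).clm_apply (differentiableAt_chartField hX)

theorem mvfderiv_mlieBracket {f : M → F} {x : M} (hf : CMDiffAt 2 f x)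
    {X Y : Π x : M, TangentSpace 𝓘(ℝ, E) x} (hX : MDiffAt (T% X) x) (hY : MDiffAt (T% Y) x) :
    d% f x (mlieBracket 𝓘(ℝ, E) X Y x) =
      d% (fun y ↦ d% f y (Y y)) x (X x) - d% (fun y ↦ d% f y (X y)) x (Y x) := by
  rw [mvfderiv_eq_fderiv_chart (hf.mdifferentiableAt (by simp)), chartField_mlieBracket,
    fderiv_apply_lieBracket (contDiffAt_comp_extChartAt_symm hf) (by simp)
      (differentiableAt_chartField hY) (differentiableAt_chartField hX),
    mvfderiv_eq_fderiv_chart (mdifferentiableAt_mvfderiv_apply hf hY),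
    mvfderiv_eq_fderiv_chart (mdifferentiableAt_mvfderiv_apply hf hX),
    (fderiv_comp_extChartAt_symm_eventuallyEq hf X).fderiv_eq,
    (fderiv_comp_extChartAt_symm_eventuallyEq hf Y).fderiv_eq]

end

theorem exists_contMDiff_vectorField_apply_eq [FiniteDimensional ℝ E] [IsManifold 𝓘(ℝ, E) ∞ M]
    [T2Space M] {x : M} (v : TangentSpace 𝓘(ℝ, E) x) :
    ∃ X : Π x : M, TangentSpace 𝓘(ℝ, E) x, CMDiff ∞ (T% X) ∧ X x = v := by
  obtain ⟨s, hs, hsmooth⟩ := FiberBundle.exists_contMDiffOn_extend (I := 𝓘(ℝ, E)) (k := ∞) E v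
  obtain ⟨u, hus, hu, hxu⟩ := mem_nhds_iff.1 hs
  obtain ⟨f, -, hf⟩ := (SmoothBumpFunction.nhds_basis_tsupport (I := 𝓘(ℝ, E)) x).mem_iff.1
    (hu.mem_nhds hxu)
  refine ⟨(f : M → ℝ) • FiberBundle.extend E v, ?_, by simp⟩
  exact f.contMDiff.contMDiffOn.smul_section_of_tsupport hu hf (hsmooth.mono hus)

theorem mvfderiv_congr {k l : M → F} {x : M} (hkl : k =ᶠ[nhds x] l) : d% k x = d% l x := by
  ext v
  exact congrArg (fun L : E →L[ℝ] F ↦ L v) hkl.mfderiv_eq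

theorem writtenInExtChartAt_self_apply (k : M → F) (x : M) :
    writtenInExtChartAt 𝓘(ℝ, E) 𝓘(ℝ, F) x k (extChartAt 𝓘(ℝ, E) x x) = k x :=
  congrArg k (extChartAt_to_inv x)

theorem mvfderiv_clm_apply {G : Type*} [NormedAddCommGroup G] [NormedSpace ℝ G]
    {L : M → F →L[ℝ] G} {u : M → F} {x : M}
    (hL : MDiffAt L x) (hu : MDiffAt u x) (v : TangentSpace 𝓘(ℝ, E) x) :
    d% (fun y ↦ L y (u y)) x v = d% L x v (u x) + L x (d% u x v) := by
  have hLu : MDiffAt (fun y ↦ L y (u y)) x := hL.clm_apply hu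
  rw [hLu.mvfderiv, hL.mvfderiv, hu.mvfderiv]
  have hprod (w : E) := DFunLike.congr_fun
    (fderivWithin_clm_apply (x := extChartAt 𝓘(ℝ, E) x x) 𝓘(ℝ, E).uniqueDiffWithinAt_image
      hL.differentiableWithinAt_writtenInExtChartAt hu.differentiableWithinAt_writtenInExtChartAt) w
  simp only [add_apply, ContinuousLinearMap.comp_apply, ContinuousLinearMap.flip_apply] at hprod
  rw [writtenInExtChartAt_self_apply L, writtenInExtChartAt_self_apply u] at hprod
  exact (hprod v).trans (add_comm _ _)

end Charts

section Coordinates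

variable {E : Type*} [NormedAddCommGroup E] [NormedSpace ℝ E]
  {M : Type*} [TopologicalSpace M] [ChartedSpace E M]

section

variable [IsManifold 𝓘(ℝ, E) 1 M]

/-- The coordinates of a tangent vector at `q` in the trivialization of the tangent bundle
at `p`. -/
def coord (p : M) {q : M} (v : TangentSpace 𝓘(ℝ, E) q) : E :=
  (trivializationAt E (TangentSpace 𝓘(ℝ, E) : M → Type _) p ⟨q, v⟩).2

/-- The tangent vector at `q` with given coordinates in the trivialization of the tangent bundle
at `p`. It is `0` for `q` outside the chart at `p`. -/
def coordSymm (p q : M) : E →L[ℝ] TangentSpace 𝓘(ℝ, E) q :=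
  (trivializationAt E (TangentSpace 𝓘(ℝ, E) : M → Type _) p).symmL ℝ q

theorem coordSymm_coord {p q : M} (hq : q ∈ (chartAt E p).source) (v : TangentSpace 𝓘(ℝ, E) q) :
    coordSymm p q (coord p v) = v := by
  rw [coordSymm, Trivialization.symmL_apply _ hq]
  exact (trivializationAt E (TangentSpace 𝓘(ℝ, E) : M → Type _) p).symm_apply_apply_mk hq v

theorem coord_coordSymm {p q : M} (hq : q ∈ (chartAt E p).source) (a : E) :
    coord p (coordSymm p q a) = a := by
  rw [coordSymm, Trivialization.symmL_apply _ hq]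
  exact congrArg Prod.snd
    ((trivializationAt E (TangentSpace 𝓘(ℝ, E) : M → Type _) p).apply_mk_symm hq a)

theorem coord_zero {p q : M} (hq : q ∈ (chartAt E p).source) :
    coord p (0 : TangentSpace 𝓘(ℝ, E) q) = 0 := by
  rw [← map_zero (coordSymm p q), coord_coordSymm hq]

theorem extend_eq_coordSymm {x q : M} (hq : q ∈ (chartAt E x).source)
    (v : TangentSpace 𝓘(ℝ, E) x) :
    (FiberBundle.extend E v : Π y : M, TangentSpace 𝓘(ℝ, E) y) q = coordSymm x q (coord x v) := by
  rw [coordSymm, Trivialization.symmL_apply _ hq]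
  rfl

theorem extend_zero_eventuallyEq (x : M) :
    (FiberBundle.extend E (0 : TangentSpace 𝓘(ℝ, E) x) : Π y : M, TangentSpace 𝓘(ℝ, E) y)
      =ᶠ[nhds x] 0 := by
  filter_upwards [chart_source_mem_nhds E x] with q hq
  rw [extend_eq_coordSymm hq, coord_zero (mem_chart_source E x), map_zero]
  rfl

theorem coord_eq_mfderiv {p q : M} (hq : q ∈ (chartAt E p).source)
    (v : TangentSpace 𝓘(ℝ, E) q) :
    coord p v = mfderiv 𝓘(ℝ, E) 𝓘(ℝ, E) (extChartAt 𝓘(ℝ, E) p) q v := by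
  refine Eq.trans ?_ (congrArg (fun L : TangentSpace 𝓘(ℝ, E) q →L[ℝ] E ↦ L v)
    (TangentBundle.continuousLinearMapAt_trivializationAt hq))
  rw [Trivialization.continuousLinearMapAt_apply, Trivialization.linearMapAt_apply]
  exact (if_pos hq).symm

theorem chartField_extend_eventuallyEq {x : M} (v : TangentSpace 𝓘(ℝ, E) x) :
    chartField (FiberBundle.extend E v : Π y : M, TangentSpace 𝓘(ℝ, E) y) x
      =ᶠ[nhds (extChartAt 𝓘(ℝ, E) x x)] fun _ ↦ coord x v := by
  filter_upwards [extChartAt_target_mem_nhds (I := 𝓘(ℝ, E)) x] with z hz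
  have hz_source : (extChartAt 𝓘(ℝ, E) x).symm z ∈ (chartAt E x).source := by
    simpa using (extChartAt 𝓘(ℝ, E) x).map_target hz
  have hsymmL := TangentBundle.symmL_trivializationAt (I := 𝓘(ℝ, E)) hz_source
  rw [(extChartAt 𝓘(ℝ, E) x).right_inv hz, modelWithCornersSelf_coe, Set.range_id,
    mfderivWithin_univ] at hsymmL
  rw [chartField, mpullback_apply, extend_eq_coordSymm hz_source]
  refine Eq.trans (congrArg _ ?_) ((isInvertible_mfderiv_extChartAt_symm hz).inverse_apply_self _)
  exact congrArg (fun L : E →L[ℝ] TangentSpace 𝓘(ℝ, E) ((extChartAt 𝓘(ℝ, E) x).symm z) ↦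
    L (coord x v)) hsymmL

end

theorem leviCivita_extend_zero [FiniteDimensional ℝ E] [IsManifold 𝓘(ℝ, E) ∞ M]
    (g : ContMDiffRiemannianMetric 𝓘(ℝ, E) ∞ E (fun x : M ↦ TangentSpace 𝓘(ℝ, E) x)) (x : M) :
    leviCivita g (FiberBundle.extend E (0 : TangentSpace 𝓘(ℝ, E) x)) x = 0 := by
  rw [(leviCivita g).isCovariantDerivativeOn.congr_of_eventuallyEq (mdiff_extend _)
    (mdifferentiable_zeroSection _ _ x) Filter.univ_mem (extend_zero_eventuallyEq x)]
  exact congrFun (leviCivita g).zero x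

theorem mlieBracket_extend [IsManifold 𝓘(ℝ, E) 2 M] {x : M} (v w : TangentSpace 𝓘(ℝ, E) x) :
    mlieBracket 𝓘(ℝ, E) (FiberBundle.extend E v) (FiberBundle.extend E w) x = 0 := by
  have hinv : (mfderiv 𝓘(ℝ, E) 𝓘(ℝ, E) (extChartAt 𝓘(ℝ, E) x) x).IsInvertible :=
    isInvertible_mfderiv_extChartAt (mem_extChartAt_source x)
  apply hinv.injective
  rw [mfderiv_extChartAt_apply, chartField_mlieBracket, map_zero,
    (chartField_extend_eventuallyEq v).lieBracket_vectorField_eq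
      (chartField_extend_eventuallyEq w)]
  simp only [lieBracket, fderiv_fun_const, Pi.zero_apply, zero_apply, sub_self]
  rfl

variable [IsManifold 𝓘(ℝ, E) ∞ M]
  (g : ContMDiffRiemannianMetric 𝓘(ℝ, E) ∞ E (fun x : M ↦ TangentSpace 𝓘(ℝ, E) x))

/-- The metric at `q`, read in the trivialization of the tangent bundle at `p`. -/
def coordMetric (p q : M) : E →L[ℝ] E →L[ℝ] ℝ :=
  ContinuousLinearMap.inCoordinates E (fun x : M ↦ TangentSpace 𝓘(ℝ, E) x) (E →L[ℝ] ℝ)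
    (fun x : M ↦ TangentSpace 𝓘(ℝ, E) x →L[ℝ] Bundle.Trivial M ℝ x) p q p q (g.inner q)

theorem contMDiffAt_coordMetric (p : M) : CMDiffAt ∞ (coordMetric g p) p :=
  ((contMDiffAt_hom_bundle _).1 (g.contMDiff p)).2

theorem mdifferentiableAt_coordMetric (p : M) : MDiffAt (coordMetric g p) p :=
  (contMDiffAt_coordMetric g p).mdifferentiableAt (by simp)

theorem coordMetric_apply {p q : M} (hq : q ∈ (chartAt E p).source) (a b : E) :
    coordMetric g p q a b = g.inner q (coordSymm p q a) (coordSymm p q b) := by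
  have hbase : q ∈ (trivializationAt E (TangentSpace 𝓘(ℝ, E) : M → Type _) p).baseSet := hq
  have hbase_dual : q ∈ (trivializationAt (E →L[ℝ] ℝ)
      (fun x : M ↦ TangentSpace 𝓘(ℝ, E) x →L[ℝ] Bundle.Trivial M ℝ x) p).baseSet := ⟨hq, trivial⟩
  rw [coordMetric, ContinuousLinearMap.inCoordinates_eq hbase hbase_dual]
  simp [coordSymm, hom_trivializationAt_apply, ContinuousLinearMap.inCoordinates,
    Trivialization.symmL_apply _ hbase]

theorem coordMetric_coord {p q : M} (hq : q ∈ (chartAt E p).source)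
    (v w : TangentSpace 𝓘(ℝ, E) q) :
    coordMetric g p q (coord p v) (coord p w) = g.inner q v w := by
  rw [coordMetric_apply g hq, coordSymm_coord hq, coordSymm_coord hq]

theorem mvfderiv_coordMetric [FiniteDimensional ℝ E] (p : M) (u v w : TangentSpace 𝓘(ℝ, E) p) :
    d% (coordMetric g p) p u (coord p v) (coord p w) =
      g.inner p (leviCivita g (FiberBundle.extend E v) p u) w
        + g.inner p v (leviCivita g (FiberBundle.extend E w) p u) := by
  have hcompat := leviCivita_metric g (mdiff_extend u) (mdiff_extend v) (mdiff_extend w)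
  simp only [FiberBundle.extend_apply_self] at hcompat
  have hextend : (fun q ↦ g.inner q (FiberBundle.extend E v q) (FiberBundle.extend E w q))
      =ᶠ[nhds p] fun q ↦ coordMetric g p q (coord p v) (coord p w) := by
    filter_upwards [chart_source_mem_nhds E p] with q hq
    rw [coordMetric_apply g hq, extend_eq_coordSymm hq, extend_eq_coordSymm hq]
  have hG := mdifferentiableAt_coordMetric g p
  rw [← hcompat, mvfderiv_congr hextend,
    mvfderiv_clm_apply (hG.clm_apply mdifferentiableAt_const) mdifferentiableAt_const,
    mvfderiv_clm_apply hG mdifferentiableAt_const]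
  simp [mvfderiv_const]

end Coordinates

section PullbackConnection

variable {E : Type*} [NormedAddCommGroup E] [NormedSpace ℝ E]
  {M : Type*} [TopologicalSpace M] [ChartedSpace E M]
  {E' : Type*} [NormedAddCommGroup E'] [NormedSpace ℝ E']
  {N : Type*} [TopologicalSpace N] [ChartedSpace E' N]
  {Ψ : M → N} {x : M}

theorem contMDiffAt_extChartAt_comp (hΨ : CMDiffAt 2 Ψ x) :
    CMDiffAt 2 (extChartAt 𝓘(ℝ, E') (Ψ x) ∘ Ψ) x :=
  contMDiffAt_extChartAt.comp x hΨ

section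

variable [IsManifold 𝓘(ℝ, E') 1 N]

/-- The coordinates of a section of `Ψ⁻¹TN` near `x`, in the trivialization of `TN` at `Ψ x`. -/
def pullbackCoord (Ψ : M → N) (σ : Π x : M, TangentSpace 𝓘(ℝ, E') (Ψ x)) (x y : M) : E' :=
  coord (Ψ x) (σ y)

theorem pullbackCoord_zero_eventuallyEq (hΨ : ContinuousAt Ψ x) :
    pullbackCoord Ψ (0 : Π x : M, TangentSpace 𝓘(ℝ, E') (Ψ x)) x =ᶠ[nhds x] 0 :=
  (hΨ.eventually (chart_source_mem_nhds E' (Ψ x))).mono fun _ hy ↦ coord_zero hy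

theorem pullbackCoord_mfderiv_apply {y : M} (hΨ : MDiffAt Ψ y)
    (hy : Ψ y ∈ (chartAt E' (Ψ x)).source) (X : Π x : M, TangentSpace 𝓘(ℝ, E) x) :
    pullbackCoord Ψ (fun y ↦ mfderiv 𝓘(ℝ, E) 𝓘(ℝ, E') Ψ y (X y)) x y =
      d% (extChartAt 𝓘(ℝ, E') (Ψ x) ∘ Ψ) y (X y) := by
  have hchart : MDiffAt (extChartAt 𝓘(ℝ, E') (Ψ x)) (Ψ y) :=
    (contMDiffAt_extChartAt' (n := 1) hy).mdifferentiableAt (by simp)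
  rw [pullbackCoord, coord_eq_mfderiv hy, mvfderiv, mfderiv_comp y hchart hΨ]
  rfl

end

section

variable [IsManifold 𝓘(ℝ, E) 2 M] [IsManifold 𝓘(ℝ, E') 2 N]

theorem pullbackCoord_mfderiv_eventuallyEq (hΨ : CMDiffAt 2 Ψ x)
    (X : Π x : M, TangentSpace 𝓘(ℝ, E) x) :
    pullbackCoord Ψ (fun y ↦ mfderiv 𝓘(ℝ, E) 𝓘(ℝ, E') Ψ y (X y)) x =ᶠ[nhds x]
      fun y ↦ d% (extChartAt 𝓘(ℝ, E') (Ψ x) ∘ Ψ) y (X y) := by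
  filter_upwards [(contMDiffAt_iff_contMDiffAt_nhds (I := 𝓘(ℝ, E)) (I' := 𝓘(ℝ, E')) (by simp)).1 hΨ,
    hΨ.continuousAt.eventually (chart_source_mem_nhds E' (Ψ x))] with y hΨy hy
  exact pullbackCoord_mfderiv_apply (hΨy.mdifferentiableAt (by simp)) hy X

theorem mdifferentiableAt_pullbackCoord_mfderiv [CompleteSpace E] (hΨ : CMDiffAt 2 Ψ x)
    {X : Π x : M, TangentSpace 𝓘(ℝ, E) x} (hX : MDiffAt (T% X) x) :
    MDiffAt (pullbackCoord Ψ (fun y ↦ mfderiv 𝓘(ℝ, E) 𝓘(ℝ, E') Ψ y (X y)) x) x :=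
  (mdifferentiableAt_mvfderiv_apply (contMDiffAt_extChartAt_comp hΨ) hX).congr_of_eventuallyEq
    (pullbackCoord_mfderiv_eventuallyEq hΨ X)

end

variable [IsManifold 𝓘(ℝ, E') ∞ N]
  (h : ContMDiffRiemannianMetric 𝓘(ℝ, E') ∞ E' (fun y : N ↦ TangentSpace 𝓘(ℝ, E') y))

theorem inner_eventuallyEq_coordMetric (hΨ : ContinuousAt Ψ x)
    (σ τ : Π x : M, TangentSpace 𝓘(ℝ, E') (Ψ x)) :
    (fun y ↦ h.inner (Ψ y) (σ y) (τ y)) =ᶠ[nhds x]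
      fun y ↦ coordMetric h (Ψ x) (Ψ y) (pullbackCoord Ψ σ x y) (pullbackCoord Ψ τ x y) :=
  (hΨ.eventually (chart_source_mem_nhds E' (Ψ x))).mono fun _ hy ↦ (coordMetric_coord h hy _ _).symm

theorem mdifferentiableAt_coordMetric_comp (hΨ : MDiffAt Ψ x) :
    MDiffAt (fun y ↦ coordMetric h (Ψ x) (Ψ y)) x :=
  (mdifferentiableAt_coordMetric h (Ψ x)).comp x hΨ

/-- The pullback `Ψ^*h` of the metric of `N`, evaluated on two vector fields. -/
def pullbackForm (Ψ : M → N) (X Y : Π x : M, TangentSpace 𝓘(ℝ, E) x) (x : M) : ℝ :=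
  h.inner (Ψ x) (mfderiv 𝓘(ℝ, E) 𝓘(ℝ, E') Ψ x (X x)) (mfderiv 𝓘(ℝ, E) 𝓘(ℝ, E') Ψ x (Y x))

theorem pullbackForm_comm (X Y : Π x : M, TangentSpace 𝓘(ℝ, E) x) :
    pullbackForm h Ψ X Y = pullbackForm h Ψ Y X :=
  funext fun x ↦ h.symm (Ψ x) _ _

theorem mdifferentiableAt_pullbackForm [FiniteDimensional ℝ E] [IsManifold 𝓘(ℝ, E) 2 M]
    (hΨ : CMDiffAt 2 Ψ x) {X Y : Π x : M, TangentSpace 𝓘(ℝ, E) x}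
    (hX : MDiffAt (T% X) x) (hY : MDiffAt (T% Y) x) :
    MDiffAt (pullbackForm h Ψ X Y) x :=
  (((mdifferentiableAt_coordMetric_comp h (hΨ.mdifferentiableAt (by simp))).clm_apply
    (mdifferentiableAt_pullbackCoord_mfderiv hΨ hX)).clm_apply
    (mdifferentiableAt_pullbackCoord_mfderiv hΨ hY)).congr_of_eventuallyEq
    (inner_eventuallyEq_coordMetric h hΨ.continuousAt _ _)

variable [FiniteDimensional ℝ E']

theorem pullbackNabla_apply (σ : Π x : M, TangentSpace 𝓘(ℝ, E') (Ψ x))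
    (v : TangentSpace 𝓘(ℝ, E) x) :
    pullbackNabla h Ψ σ x v =
      coordSymm (Ψ x) (Ψ x) (d% (pullbackCoord Ψ σ x) x v)
      + leviCivita h (FiberBundle.extend E' (σ x)) (Ψ x) (mfderiv 𝓘(ℝ, E) 𝓘(ℝ, E') Ψ x v) := rfl

theorem pullbackNabla_zero (hΨ : ContinuousAt Ψ x) (v : TangentSpace 𝓘(ℝ, E) x) :
    pullbackNabla h Ψ (0 : Π x : M, TangentSpace 𝓘(ℝ, E') (Ψ x)) x v = 0 := by
  rw [pullbackNabla_apply, mvfderiv_congr (pullbackCoord_zero_eventuallyEq hΨ), Pi.zero_apply,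
    leviCivita_extend_zero, mvfderiv_zero, zero_apply, zero_apply, map_zero, add_zero]

/-- In coordinates this is the product rule for `coordMetric`, whose derivative is expressed through
the Levi-Civita connection. -/
theorem mvfderiv_inner_pullback (hΨ : MDiffAt Ψ x)
    {σ τ : Π x : M, TangentSpace 𝓘(ℝ, E') (Ψ x)}
    (hσ : MDiffAt (pullbackCoord Ψ σ x) x) (hτ : MDiffAt (pullbackCoord Ψ τ x) x)
    (v : TangentSpace 𝓘(ℝ, E) x) :
    d% (fun y ↦ h.inner (Ψ y) (σ y) (τ y)) x v =
      h.inner (Ψ x) (pullbackNabla h Ψ σ x v) (τ x)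
        + h.inner (Ψ x) (σ x) (pullbackNabla h Ψ τ x v) := by
  have hG := mdifferentiableAt_coordMetric_comp h hΨ
  have hx := mem_chart_source E' (Ψ x)
  have hdG : d% (fun y ↦ coordMetric h (Ψ x) (Ψ y)) x v =
      d% (coordMetric h (Ψ x)) (Ψ x) (mfderiv 𝓘(ℝ, E) 𝓘(ℝ, E') Ψ x v) :=
    mfderiv_comp_apply x (mdifferentiableAt_coordMetric h (Ψ x)) hΨ v
  rw [mvfderiv_congr (inner_eventuallyEq_coordMetric h hΨ.continuousAt σ τ),
    mvfderiv_clm_apply (hG.clm_apply hσ) hτ, mvfderiv_clm_apply hG hσ, add_apply, hdG,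
    pullbackNabla_apply, pullbackNabla_apply, coordMetric_apply h hx, coordMetric_apply h hx]
  simp only [pullbackCoord, mvfderiv_coordMetric, coordSymm_coord hx, map_add, add_apply]
  ring

variable [FiniteDimensional ℝ E]

theorem pullbackNabla_mfderiv_sub [IsManifold 𝓘(ℝ, E) 2 M] (hΨ : CMDiffAt 2 Ψ x)
    {X Y : Π x : M, TangentSpace 𝓘(ℝ, E) x}
    (hX : MDiffAt (T% X) x) (hY : MDiffAt (T% Y) x) :
    pullbackNabla h Ψ (fun y ↦ mfderiv 𝓘(ℝ, E) 𝓘(ℝ, E') Ψ y (Y y)) x (X x)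
      - pullbackNabla h Ψ (fun y ↦ mfderiv 𝓘(ℝ, E) 𝓘(ℝ, E') Ψ y (X y)) x (Y x)
      = mfderiv 𝓘(ℝ, E) 𝓘(ℝ, E') Ψ x (mlieBracket 𝓘(ℝ, E) X Y x) := by
  have hx := mem_chart_source E' (Ψ x)
  have hbracket := mvfderiv_mlieBracket (contMDiffAt_extChartAt_comp hΨ) hX hY
  rw [← pullbackCoord_mfderiv_apply (hΨ.mdifferentiableAt (by simp)) hx
    (mlieBracket 𝓘(ℝ, E) X Y)] at hbracket
  have htorsion := (CovariantDerivative.torsion_eq_zero_iff _).1 (leviCivita_torsion h)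
    (mdiff_extend (mfderiv 𝓘(ℝ, E) 𝓘(ℝ, E') Ψ x (X x)))
    (mdiff_extend (mfderiv 𝓘(ℝ, E) 𝓘(ℝ, E') Ψ x (Y x)))
  rw [mlieBracket_extend] at htorsion
  simp only [FiberBundle.extend_apply_self] at htorsion
  rw [pullbackNabla_apply, pullbackNabla_apply,
    mvfderiv_congr (pullbackCoord_mfderiv_eventuallyEq hΨ X),
    mvfderiv_congr (pullbackCoord_mfderiv_eventuallyEq hΨ Y), add_sub_add_comm, htorsion, add_zero,
    ← map_sub, ← hbracket]
  exact coordSymm_coord hx _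

theorem two_inner_pullbackNabla [IsManifold 𝓘(ℝ, E) 2 M] (hΨ : CMDiffAt 2 Ψ x)
    {X Y Z : Π x : M, TangentSpace 𝓘(ℝ, E) x} (hX : MDiffAt (T% X) x) (hY : MDiffAt (T% Y) x)
    (hZ : MDiffAt (T% Z) x) :
    2 * h.inner (Ψ x)
        (pullbackNabla h Ψ (fun y ↦ mfderiv 𝓘(ℝ, E) 𝓘(ℝ, E') Ψ y (Z y)) x (X x))
        (mfderiv 𝓘(ℝ, E) 𝓘(ℝ, E') Ψ x (Y x)) =
      d% (pullbackForm h Ψ Z Y) x (X x) + d% (pullbackForm h Ψ X Y) x (Z x)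
        - d% (pullbackForm h Ψ X Z) x (Y x)
        + pullbackForm h Ψ (mlieBracket 𝓘(ℝ, E) X Z) Y x
        - pullbackForm h Ψ (mlieBracket 𝓘(ℝ, E) X Y) Z x
        - pullbackForm h Ψ (mlieBracket 𝓘(ℝ, E) Z Y) X x := by
  have hcompat {A B : Π x : M, TangentSpace 𝓘(ℝ, E) x} (hA : MDiffAt (T% A) x)
      (hB : MDiffAt (T% B) x) (v : TangentSpace 𝓘(ℝ, E) x) :=
    mvfderiv_inner_pullback h (hΨ.mdifferentiableAt (by simp))
      (mdifferentiableAt_pullbackCoord_mfderiv hΨ hA)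
      (mdifferentiableAt_pullbackCoord_mfderiv hΨ hB) v
  unfold pullbackForm
  rw [hcompat hZ hY, hcompat hX hY, hcompat hX hZ, ← pullbackNabla_mfderiv_sub h hΨ hX hZ,
    ← pullbackNabla_mfderiv_sub h hΨ hX hY, ← pullbackNabla_mfderiv_sub h hΨ hZ hY]
  simp only [map_sub, sub_apply, h.symm (Ψ x) (mfderiv 𝓘(ℝ, E) 𝓘(ℝ, E') Ψ x _)]
  ring

end PullbackConnection

section HorizontalLift

variable {E : Type*} [NormedAddCommGroup E] [NormedSpace ℝ E] [FiniteDimensional ℝ E]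
  {E' : Type*} [NormedAddCommGroup E'] [NormedSpace ℝ E']

theorem finrank_clm_real : Module.finrank ℝ (E →L[ℝ] ℝ) = Module.finrank ℝ E :=
  (LinearMap.toContinuousLinearMap : (E →ₗ[ℝ] ℝ) ≃ₗ[ℝ] (E →L[ℝ] ℝ)).finrank_eq.symm.trans
    Subspace.dual_finrank_eq

theorem isInvertible_of_injective [FiniteDimensional ℝ E'] {L : E →L[ℝ] E'}
    (hL : Function.Injective L) (hfinrank : Module.finrank ℝ E = Module.finrank ℝ E') :
    L.IsInvertible :=
  ⟨(LinearEquiv.ofInjectiveOfFinrankEq L.toLinearMap hL hfinrank).toContinuousLinearEquiv, rfl⟩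

theorem isInvertible_of_definite {G : E →L[ℝ] E →L[ℝ] ℝ} (hG : ∀ a, G a a = 0 → a = 0) :
    G.IsInvertible :=
  isInvertible_of_injective
    ((injective_iff_map_eq_zero G).2 fun a ha ↦ hG a (by rw [ha, zero_apply]))
    finrank_clm_real.symm

/-- The adjoint `ξ ↦ G⁻¹ (ξ ∘ P)` of `P` with respect to the bilinear form `G`. -/
def formAdjoint (G : E →L[ℝ] E →L[ℝ] ℝ) (P : E →L[ℝ] E') : (E' →L[ℝ] ℝ) →L[ℝ] E :=
  G.inverse ∘L (ContinuousLinearMap.compL ℝ E E' ℝ).flip P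

/-- The right inverse `P^* (P P^*)⁻¹` of a surjective map `P`, where `P^*` is the adjoint of `P`
with respect to `G`. Its range is the `G`-orthogonal complement of `ker P`. -/
def horizontalLift (G : E →L[ℝ] E →L[ℝ] ℝ) (P : E →L[ℝ] E') : E' →L[ℝ] E :=
  formAdjoint G P ∘L (P ∘L formAdjoint G P).inverse

variable {G : E →L[ℝ] E →L[ℝ] ℝ} {P : E →L[ℝ] E'}

theorem apply_formAdjoint (hG : ∀ a, G a a = 0 → a = 0) (ξ : E' →L[ℝ] ℝ) (k : E) :
    G (formAdjoint G P ξ) k = ξ (P k) :=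
  DFunLike.congr_fun ((isInvertible_of_definite hG).self_apply_inverse (ξ ∘L P)) k

variable [FiniteDimensional ℝ E']

theorem isInvertible_comp_formAdjoint (hG : ∀ a, G a a = 0 → a = 0)
    (hP : Function.Surjective P) : (P ∘L formAdjoint G P).IsInvertible := by
  refine isInvertible_of_injective ((injective_iff_map_eq_zero _).2 fun ξ hξ ↦ ?_)
    finrank_clm_real
  have hlift : formAdjoint G P ξ = 0 := hG _ (by
    rw [apply_formAdjoint hG, ← ContinuousLinearMap.comp_apply P, hξ, map_zero])
  ext b
  obtain ⟨k, rfl⟩ := hP b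
  rw [← apply_formAdjoint hG, hlift, map_zero, zero_apply, zero_apply]

theorem horizontalLift_apply_eq (hG : ∀ a, G a a = 0 → a = 0) (hP : Function.Surjective P)
    {c : E} (hc : ∀ k, P k = 0 → G c k = 0) : horizontalLift G P (P c) = c := by
  have hright : P (horizontalLift G P (P c)) = P c :=
    (isInvertible_comp_formAdjoint hG hP).self_apply_inverse (P c)
  have hker : P (horizontalLift G P (P c) - c) = 0 := by rw [map_sub, hright, sub_self]
  have horth : G (horizontalLift G P (P c)) (horizontalLift G P (P c) - c) = 0 :=
    (apply_formAdjoint hG _ _).trans (by rw [hker, map_zero])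
  refine sub_eq_zero.1 (hG _ ?_)
  rw [G.map_sub, sub_apply, horth, hc _ hker, sub_zero]

theorem contDiffAt_horizontalLift (hG : ∀ a, G a a = 0 → a = 0) (hP : Function.Surjective P) :
    ContDiffAt ℝ ∞ (fun p : (E →L[ℝ] E →L[ℝ] ℝ) × (E →L[ℝ] E') ↦ horizontalLift p.1 p.2)
      (G, P) := by
  have hinverse : ContDiffAt ℝ ∞
      (fun p : (E →L[ℝ] E →L[ℝ] ℝ) × (E →L[ℝ] E') ↦ p.1.inverse) (G, P) :=
    (isInvertible_of_definite hG).contDiffAt_map_inverse.comp (G, P) contDiffAt_fst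
  have hadjoint : ContDiffAt ℝ ∞
      (fun p : (E →L[ℝ] E →L[ℝ] ℝ) × (E →L[ℝ] E') ↦ formAdjoint p.1 p.2) (G, P) :=
    hinverse.clm_comp ((ContinuousLinearMap.contDiff _).contDiffAt.comp (G, P) contDiffAt_snd)
  exact hadjoint.clm_comp (ContDiffAt.comp (g := ContinuousLinearMap.inverse) (G, P)
    (isInvertible_comp_formAdjoint hG hP).contDiffAt_map_inverse
    (contDiffAt_snd.clm_comp hadjoint))

end HorizontalLift

section Projections

variable {E : Type*} [NormedAddCommGroup E] [NormedSpace ℝ E] [FiniteDimensional ℝ E]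
  {H : Type*} [TopologicalSpace H] {I : ModelWithCorners ℝ E H}
  {M : Type*} [TopologicalSpace M] [ChartedSpace H M] [IsManifold I ∞ M]
  (g : ContMDiffRiemannianMetric I ∞ E (fun x : M ↦ TangentSpace I x))
  {E' : Type*} [NormedAddCommGroup E'] [NormedSpace ℝ E']
  {H' : Type*} [TopologicalSpace H'] {J : ModelWithCorners ℝ E' H'}
  {N : Type*} [TopologicalSpace N] [ChartedSpace H' N]
  {Ψ : M → N} {x : M}

omit [FiniteDimensional ℝ E] in
theorem mem_orth {K : Submodule ℝ (TangentSpace I x)} {v : TangentSpace I x} :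
    v ∈ orth g x K ↔ ∀ w ∈ K, g.inner x w v = 0 :=
  LinearMap.BilinForm.mem_orthogonal_iff

omit [FiniteDimensional ℝ E] [IsManifold I ∞ M] in
theorem mem_vert {v : TangentSpace I x} : v ∈ vert I J Ψ x ↔ mfderiv I J Ψ x v = 0 :=
  LinearMap.mem_ker

omit [FiniteDimensional ℝ E] in
theorem inner_vert_hor {u v : TangentSpace I x} (hu : u ∈ vert I J Ψ x)
    (hv : v ∈ hor g J Ψ x) : g.inner x u v = 0 :=
  (mem_orth g).1 hv u hu

omit [FiniteDimensional ℝ E] in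
theorem inner_hor_vert {u v : TangentSpace I x} (hu : u ∈ hor g J Ψ x)
    (hv : v ∈ vert I J Ψ x) : g.inner x u v = 0 := by
  rw [g.symm, inner_vert_hor g hv hu]

omit [FiniteDimensional ℝ E] in
theorem eq_zero_of_inner_self {v : TangentSpace I x} (hv : g.inner x v v = 0) : v = 0 :=
  by_contra fun hne ↦ (g.pos x v hne).ne' hv

theorem vProj_mem (v : TangentSpace I x) : vProj g J Ψ x v ∈ vert I J Ψ x := by
  simp [vProj]

theorem hProj_mem (v : TangentSpace I x) : hProj g J Ψ x v ∈ hor g J Ψ x := by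
  simp [hProj, hor]

theorem vProj_add_hProj (v : TangentSpace I x) : vProj g J Ψ x v + hProj g J Ψ x v = v := by
  simp [hProj, vProj, Submodule.projection_add_projection_eq_self]

theorem vProj_eq_self {v : TangentSpace I x} (hv : v ∈ vert I J Ψ x) :
    vProj g J Ψ x v = v := by
  simp [vProj, hv]

theorem hProj_eq_zero {v : TangentSpace I x} (hv : v ∈ vert I J Ψ x) :
    hProj g J Ψ x v = 0 := by
  simp [hProj, hv]

theorem hProj_eq_self {v : TangentSpace I x} (hv : v ∈ hor g J Ψ x) :
    hProj g J Ψ x v = v := by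
  simp [hProj, show v ∈ orth g x _ from hv]

theorem vProj_eq_zero {v : TangentSpace I x} (hv : v ∈ hor g J Ψ x) :
    vProj g J Ψ x v = 0 := by
  simp [vProj, show v ∈ orth g x _ from hv]

theorem inner_hProj_left (u : TangentSpace I x) {v : TangentSpace I x} (hv : v ∈ hor g J Ψ x) :
    g.inner x (hProj g J Ψ x u) v = g.inner x u v := by
  conv_rhs => rw [← vProj_add_hProj g (J := J) (Ψ := Ψ) u, map_add, add_apply,
    inner_vert_hor g (vProj_mem g u) hv, zero_add]

theorem mem_vert_of_inner_hor {u : TangentSpace I x} (hu : ∀ v ∈ hor g J Ψ x, g.inner x u v = 0) :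
    u ∈ vert I J Ψ x := by
  have hzero : hProj g J Ψ x u = 0 := eq_zero_of_inner_self g <| by
    rw [inner_hProj_left g u (hProj_mem g u), hu _ (hProj_mem g u)]
  rw [← vProj_add_hProj g (J := J) (Ψ := Ψ) u, hzero, add_zero]
  exact vProj_mem g u

theorem mfderiv_hProj (v : TangentSpace I x) :
    mfderiv I J Ψ x (hProj g J Ψ x v) = mfderiv I J Ψ x v := by
  conv_rhs => rw [← vProj_add_hProj g (J := J) (Ψ := Ψ) v, map_add, mem_vert.1 (vProj_mem g v)]
  exact (zero_add _).symm

end Projections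

section SmoothProjections

variable {E : Type*} [NormedAddCommGroup E] [NormedSpace ℝ E]
  {M : Type*} [TopologicalSpace M] [ChartedSpace E M]
  {E' : Type*} [NormedAddCommGroup E'] [NormedSpace ℝ E']
  {N : Type*} [TopologicalSpace N] [ChartedSpace E' N]
  {Ψ : M → N} {x y : M}

section

variable [IsManifold 𝓘(ℝ, E) 1 M] [IsManifold 𝓘(ℝ, E') 1 N]

/-- The differential of `Ψ` at `y`, read in the trivializations at `x` and `Ψ x`. -/
def coordDifferential (Ψ : M → N) (x y : M) : E →L[ℝ] E' :=
  inTangentCoordinates 𝓘(ℝ, E) 𝓘(ℝ, E') id Ψ (mfderiv 𝓘(ℝ, E) 𝓘(ℝ, E') Ψ) x y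

theorem coordDifferential_apply (hy : Ψ y ∈ (chartAt E' (Ψ x)).source) (a : E) :
    coordDifferential Ψ x y a =
      coord (Ψ x) (mfderiv 𝓘(ℝ, E) 𝓘(ℝ, E') Ψ y (coordSymm x y a)) :=
  Trivialization.continuousLinearMapAt_apply_of_mem _ _ hy _

theorem coordDifferential_coord (hx : y ∈ (chartAt E x).source)
    (hy : Ψ y ∈ (chartAt E' (Ψ x)).source) (v : TangentSpace 𝓘(ℝ, E) y) :
    coordDifferential Ψ x y (coord x v) = coord (Ψ x) (mfderiv 𝓘(ℝ, E) 𝓘(ℝ, E') Ψ y v) := by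
  rw [coordDifferential_apply hy, coordSymm_coord hx]

theorem coordDifferential_surjective (hx : y ∈ (chartAt E x).source)
    (hy : Ψ y ∈ (chartAt E' (Ψ x)).source)
    (hsurj : Function.Surjective (mfderiv 𝓘(ℝ, E) 𝓘(ℝ, E') Ψ y)) :
    Function.Surjective (coordDifferential Ψ x y : E →L[ℝ] E') := by
  intro b
  obtain ⟨v, hv⟩ := hsurj (coordSymm (Ψ x) (Ψ y) b)
  exact ⟨coord x v, by rw [coordDifferential_coord hx hy, hv, coord_coordSymm hy]⟩

theorem coordSymm_mem_vert (hy : Ψ y ∈ (chartAt E' (Ψ x)).source) {a : E}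
    (ha : (coordDifferential Ψ x y : E →L[ℝ] E') a = 0) :
    coordSymm x y a ∈ vert 𝓘(ℝ, E) 𝓘(ℝ, E') Ψ y := by
  rw [coordDifferential_apply hy] at ha
  rw [mem_vert, ← coordSymm_coord hy (mfderiv 𝓘(ℝ, E) 𝓘(ℝ, E') Ψ y _), ha, map_zero]

end

theorem contMDiffAt_coordDifferential [IsManifold 𝓘(ℝ, E) ∞ M] [IsManifold 𝓘(ℝ, E') ∞ N]
    (hΨ : CMDiffAt ∞ Ψ x) :
    CMDiffAt ∞ (coordDifferential Ψ x : M → E →L[ℝ] E') x :=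
  ContMDiffAt.mfderiv_const hΨ (by simp)

variable [IsManifold 𝓘(ℝ, E) ∞ M]
  (g : ContMDiffRiemannianMetric 𝓘(ℝ, E) ∞ E (fun x : M ↦ TangentSpace 𝓘(ℝ, E) x))

theorem coordMetric_definite (hx : y ∈ (chartAt E x).source) {a : E}
    (ha : coordMetric g x y a a = 0) : a = 0 := by
  rw [coordMetric_apply g hx] at ha
  rw [← coord_coordSymm hx a, eq_zero_of_inner_self g ha, coord_zero hx]

variable [IsManifold 𝓘(ℝ, E') ∞ N] [FiniteDimensional ℝ E] [FiniteDimensional ℝ E']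

/-- In coordinates the horizontal projection is `horizontalLift` composed with the differential
of `Ψ`. -/
theorem contMDiff_hProj (hΨ : CMDiff ∞ Ψ)
    (hsurj : ∀ x, Function.Surjective (mfderiv 𝓘(ℝ, E) 𝓘(ℝ, E') Ψ x))
    {X : Π x : M, TangentSpace 𝓘(ℝ, E) x} (hX : CMDiff ∞ (T% X)) :
    CMDiff ∞ (T% (fun y ↦ hProj g 𝓘(ℝ, E') Ψ y (X y))) := by
  intro x
  have hdifferential := contMDiffAt_coordDifferential (hΨ x)
  have hlift := (contDiffAt_horizontalLift
    (fun _ ↦ coordMetric_definite g (mem_chart_source E x))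
    (coordDifferential_surjective (mem_chart_source E x) (mem_chart_source E' (Ψ x))
      (hsurj x))).contMDiffAt.comp x ((contMDiffAt_coordMetric g x).prodMk_space hdifferential)
  refine (contMDiffAt_section _).2 ((hlift.clm_apply (hdifferential.clm_apply
    ((contMDiffAt_section _).1 (hX x)))).congr_of_eventuallyEq ?_)
  filter_upwards [(hΨ x).continuousAt.eventually (chart_source_mem_nhds E' (Ψ x)),
    chart_source_mem_nhds E x] with y hΨy hy
  have hsame : (coordDifferential Ψ x y : E →L[ℝ] E') (coord x (hProj g 𝓘(ℝ, E') Ψ y (X y))) =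
      (coordDifferential Ψ x y : E →L[ℝ] E') (coord x (X y)) := by
    rw [coordDifferential_coord hy hΨy, mfderiv_hProj, coordDifferential_coord hy hΨy]
  refine (horizontalLift_apply_eq (c := coord x (hProj g 𝓘(ℝ, E') Ψ y (X y)))
    (fun _ ↦ coordMetric_definite g hy) (coordDifferential_surjective hy hΨy (hsurj y))
    fun k hk ↦ ?_).symm.trans (congrArg _ hsame)
  rw [coordMetric_apply g hy, coordSymm_coord hy]
  exact inner_hor_vert g (hProj_mem g _) (coordSymm_mem_vert hΨy hk)

theorem contMDiff_vProj (hΨ : CMDiff ∞ Ψ)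
    (hsurj : ∀ x, Function.Surjective (mfderiv 𝓘(ℝ, E) 𝓘(ℝ, E') Ψ x))
    {X : Π x : M, TangentSpace 𝓘(ℝ, E) x} (hX : CMDiff ∞ (T% X)) :
    CMDiff ∞ (T% (fun y ↦ vProj g 𝓘(ℝ, E') Ψ y (X y))) := by
  refine (hX.sub_section (contMDiff_hProj g hΨ hsurj hX)).congr fun y ↦ ?_
  exact congrArg (TotalSpace.mk' E y) (eq_sub_of_add_eq (vProj_add_hProj g (X y)))

end SmoothProjections

section LeviCivita

variable {E : Type*} [NormedAddCommGroup E] [NormedSpace ℝ E] [FiniteDimensional ℝ E]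
  {H : Type*} [TopologicalSpace H] {I : ModelWithCorners ℝ E H}
  {M : Type*} [TopologicalSpace M] [ChartedSpace H M] [IsManifold I ∞ M]
  {X Y Z W : Π x : M, TangentSpace I x} {x : M}

omit [FiniteDimensional ℝ E] in
theorem mdifferentiableAt_of_contMDiff (hX : CMDiff ∞ (T% X)) (x : M) : MDiffAt (T% X) x :=
  hX.mdifferentiable (by simp) x

theorem contMDiff_mlieBracket (hX : CMDiff ∞ (T% X)) (hY : CMDiff ∞ (T% Y)) :
    CMDiff ∞ (T% (mlieBracket I X Y)) := by
  have : IsManifold I (((⊤ : ℕ∞) : WithTop ℕ∞) + 1) M := inferInstanceAs (IsManifold I ∞ M)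
  have : IsManifold I (minSmoothness ℝ 2) M := by
    rw [minSmoothness_of_isRCLikeNormedField]
    infer_instance
  exact ContDiff.mlieBracket_vectorField (m := ⊤) (n := ⊤) hX hY (by simp)

theorem mlieBracket_jacobi (hX : CMDiff ∞ (T% X)) (hY : CMDiff ∞ (T% Y)) (hZ : CMDiff ∞ (T% Z))
    (x : M) : mlieBracket I X (mlieBracket I Y Z) x =
      mlieBracket I (mlieBracket I X Y) Z x + mlieBracket I Y (mlieBracket I X Z) x := by
  have : IsManifold I (minSmoothness ℝ 3) M := by
    rw [minSmoothness_of_isRCLikeNormedField]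
    infer_instance
  have hsmooth : minSmoothness ℝ 2 ≤ ∞ := by
    rw [minSmoothness_of_isRCLikeNormedField]
    exact WithTop.coe_le_coe.2 le_top
  exact leibniz_identity_mlieBracket_apply ((hX x).of_le hsmooth) ((hY x).of_le hsmooth)
    ((hZ x).of_le hsmooth)

variable (g : ContMDiffRiemannianMetric I ∞ E (fun x : M ↦ TangentSpace I x))

theorem nabla_sub_nabla (hX : MDiffAt (T% X) x) (hY : MDiffAt (T% Y) x) :
    nabla g X Y x - nabla g Y X x = mlieBracket I X Y x :=
  (CovariantDerivative.torsion_eq_zero_iff _).1 (leviCivita_torsion g) hX hY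

theorem nabla_zero (X : Π x : M, TangentSpace I x) (x : M) : nabla g X (fun _ ↦ 0) x = 0 :=
  DFunLike.congr_fun ((leviCivita g).isCovariantDerivativeOn.zero (Set.mem_univ x)) (X x)

theorem mvfderiv_inner (hX : MDiffAt (T% X) x) (hY : MDiffAt (T% Y) x) (hZ : MDiffAt (T% Z) x) :
    d% (fun y ↦ g.inner y (Y y) (Z y)) x (X x) =
      g.inner x (nabla g X Y x) (Z x) + g.inner x (Y x) (nabla g X Z x) :=
  leviCivita_metric g hX hY hZ

theorem inner_nabla_of_orthogonal (hX : MDiffAt (T% X) x) (hY : MDiffAt (T% Y) x)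
    (hZ : MDiffAt (T% Z) x) (horth : ∀ y, g.inner y (Y y) (Z y) = 0) :
    g.inner x (nabla g X Y x) (Z x) = -g.inner x (Y x) (nabla g X Z x) := by
  rw [eq_neg_iff_add_eq_zero, ← mvfderiv_inner g hX hY hZ, funext horth, mvfderiv_const, zero_apply]

/-- The Lie derivative `L_X g` of the metric at a point, expressed through the Levi-Civita
connection so that it is a bilinear form on the tangent space. -/
def lieMetric (X : Π x : M, TangentSpace I x) (x : M) : LinearMap.BilinForm ℝ (TangentSpace I x) :=
  (metricForm g x).compLeft (leviCivita g X x).toLinearMap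
    + (metricForm g x).compRight (leviCivita g X x).toLinearMap

theorem lieMetric_apply (v w : TangentSpace I x) :
    lieMetric g X x v w =
      g.inner x (leviCivita g X x v) w + g.inner x v (leviCivita g X x w) :=
  rfl

theorem lieMetric_add (hX : MDiffAt (T% X) x) (hY : MDiffAt (T% Y) x) :
    lieMetric g (X + Y) x = lieMetric g X x + lieMetric g Y x := by
  ext v w
  simp only [lieMetric_apply, (leviCivita g).isCovariantDerivativeOn.add hX hY (Set.mem_univ x),
    add_apply, map_add, LinearMap.add_apply]
  ring

theorem lieMetric_const_smul (c : ℝ) (hX : MDiffAt (T% X) x) :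
    lieMetric g (c • X) x = c • lieMetric g X x := by
  ext v w
  simp only [lieMetric_apply,
    (leviCivita g).isCovariantDerivativeOn.smul_const c hX (Set.mem_univ x), smul_apply, map_smul,
    LinearMap.smul_apply, smul_add]

theorem mvfderiv_inner_eq_lieMetric (hX : MDiffAt (T% X) x) (hY : MDiffAt (T% Y) x)
    (hZ : MDiffAt (T% Z) x) :
    d% (fun y ↦ g.inner y (Y y) (Z y)) x (X x) =
      lieMetric g X x (Y x) (Z x) + g.inner x (mlieBracket I X Y x) (Z x)
        + g.inner x (Y x) (mlieBracket I X Z x) := by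
  rw [mvfderiv_inner g hX hY hZ, ← nabla_sub_nabla g hX hY, ← nabla_sub_nabla g hX hZ]
  simp only [lieMetric_apply, nabla, map_sub, sub_apply]
  ring

end LeviCivita

section LieMetric

variable {E : Type*} [NormedAddCommGroup E] [NormedSpace ℝ E] [FiniteDimensional ℝ E]
  {M : Type*} [TopologicalSpace M] [ChartedSpace E M] [IsManifold 𝓘(ℝ, E) ∞ M]
  (g : ContMDiffRiemannianMetric 𝓘(ℝ, E) ∞ E (fun x : M ↦ TangentSpace 𝓘(ℝ, E) x))
  {X Y Z W : Π x : M, TangentSpace 𝓘(ℝ, E) x}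

omit [FiniteDimensional ℝ E] in
theorem contMDiff_inner (hY : CMDiff ∞ (T% Y)) (hZ : CMDiff ∞ (T% Z)) :
    CMDiff ∞ (fun y ↦ g.inner y (Y y) (Z y)) := by
  have hsection : ContMDiff 𝓘(ℝ, E) (𝓘(ℝ, E).prod 𝓘(ℝ, ℝ)) ∞
      (fun y ↦ TotalSpace.mk' ℝ (E := Bundle.Trivial M ℝ) y (g.inner y (Y y) (Z y))) :=
    ContMDiff.clm_bundle_apply₂ (F₁ := E) (F₂ := E) g.contMDiff hY hZ
  exact fun y ↦ (contMDiffAt_totalSpace.1 (hsection y)).2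

theorem mdifferentiableAt_lieMetric (hX : CMDiff ∞ (T% X)) (hY : CMDiff ∞ (T% Y))
    (hZ : CMDiff ∞ (T% Z)) (x : M) : MDiffAt (fun y ↦ lieMetric g X y (Y y) (Z y)) x := by
  have hsub : (fun y ↦ lieMetric g X y (Y y) (Z y)) = fun y ↦
      d% (fun z ↦ g.inner z (Y z) (Z z)) y (X y)
        - (g.inner y (mlieBracket 𝓘(ℝ, E) X Y y) (Z y)
          + g.inner y (Y y) (mlieBracket 𝓘(ℝ, E) X Z y)) := by
    funext y
    rw [mvfderiv_inner_eq_lieMetric g (mdifferentiableAt_of_contMDiff hX y)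
      (mdifferentiableAt_of_contMDiff hY y) (mdifferentiableAt_of_contMDiff hZ y)]
    ring
  rw [hsub]
  exact (mdifferentiableAt_mvfderiv_apply
    ((contMDiff_inner g hY hZ x).of_le (WithTop.coe_le_coe.2 le_top))
    (mdifferentiableAt_of_contMDiff hX x)).sub
    (((contMDiff_inner g (contMDiff_mlieBracket hX hY) hZ).add
      (contMDiff_inner g hY (contMDiff_mlieBracket hX hZ))).mdifferentiable (by simp) x)

theorem mvfderiv_mvfderiv_inner (hY : CMDiff ∞ (T% Y)) (hZ : CMDiff ∞ (T% Z))
    (hW : CMDiff ∞ (T% W)) {x : M} (v : TangentSpace 𝓘(ℝ, E) x) :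
    d% (fun y ↦ d% (fun z ↦ g.inner z (Z z) (W z)) y (Y y)) x v =
      d% (fun y ↦ lieMetric g Y y (Z y) (W y)) x v
        + d% (fun y ↦ g.inner y (mlieBracket 𝓘(ℝ, E) Y Z y) (W y)) x v
        + d% (fun y ↦ g.inner y (Z y) (mlieBracket 𝓘(ℝ, E) Y W y)) x v := by
  have hYZ := contMDiff_mlieBracket hY hZ
  have hYW := contMDiff_mlieBracket hY hW
  have hexpand : (fun y ↦ d% (fun z ↦ g.inner z (Z z) (W z)) y (Y y)) =
      (fun y ↦ lieMetric g Y y (Z y) (W y))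
        + (fun y ↦ g.inner y (mlieBracket 𝓘(ℝ, E) Y Z y) (W y))
        + fun y ↦ g.inner y (Z y) (mlieBracket 𝓘(ℝ, E) Y W y) :=
    funext fun y ↦ mvfderiv_inner_eq_lieMetric g (mdifferentiableAt_of_contMDiff hY y)
      (mdifferentiableAt_of_contMDiff hZ y) (mdifferentiableAt_of_contMDiff hW y)
  have hlie := mdifferentiableAt_lieMetric g hY hZ hW x
  have hleft := (contMDiff_inner g hYZ hW).mdifferentiable (by simp) x
  have hright := (contMDiff_inner g hZ hYW).mdifferentiable (by simp) x
  rw [hexpand, mvfderiv_add (hlie.add hleft) hright, mvfderiv_add hlie hleft, add_apply, add_apply]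

theorem lieMetric_mlieBracket (hX : CMDiff ∞ (T% X)) (hY : CMDiff ∞ (T% Y))
    (hZ : CMDiff ∞ (T% Z)) (hW : CMDiff ∞ (T% W)) (x : M) :
    lieMetric g (mlieBracket 𝓘(ℝ, E) X Y) x (Z x) (W x) =
      (d% (fun y ↦ lieMetric g Y y (Z y) (W y)) x (X x)
          - lieMetric g Y x (mlieBracket 𝓘(ℝ, E) X Z x) (W x)
          - lieMetric g Y x (Z x) (mlieBracket 𝓘(ℝ, E) X W x))
        - (d% (fun y ↦ lieMetric g X y (Z y) (W y)) x (Y x)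
          - lieMetric g X x (mlieBracket 𝓘(ℝ, E) Y Z x) (W x)
          - lieMetric g X x (Z x) (mlieBracket 𝓘(ℝ, E) Y W x)) := by
  have hderiv {A B C : Π x : M, TangentSpace 𝓘(ℝ, E) x} (hA : CMDiff ∞ (T% A))
      (hB : CMDiff ∞ (T% B)) (hC : CMDiff ∞ (T% C)) :=
    mvfderiv_inner_eq_lieMetric g (mdifferentiableAt_of_contMDiff hA x)
      (mdifferentiableAt_of_contMDiff hB x) (mdifferentiableAt_of_contMDiff hC x)
  have hcommutator := mvfderiv_mlieBracket
    ((contMDiff_inner g hZ hW x).of_le (WithTop.coe_le_coe.2 le_top))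
    (mdifferentiableAt_of_contMDiff hX x) (mdifferentiableAt_of_contMDiff hY x)
  rw [hderiv (contMDiff_mlieBracket hX hY) hZ hW, mvfderiv_mvfderiv_inner g hY hZ hW,
    mvfderiv_mvfderiv_inner g hX hZ hW, hderiv hX (contMDiff_mlieBracket hY hZ) hW,
    hderiv hX hZ (contMDiff_mlieBracket hY hW), hderiv hY (contMDiff_mlieBracket hX hZ) hW,
    hderiv hY hZ (contMDiff_mlieBracket hX hW), mlieBracket_jacobi hX hY hZ,
    mlieBracket_jacobi hX hY hW] at hcommutator
  simp only [map_add, add_apply] at hcommutator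
  linarith

end LieMetric

section Sasakian

variable {E : Type*} [NormedAddCommGroup E] [NormedSpace ℝ E]
  {M : Type*} [TopologicalSpace M] [ChartedSpace E M] [IsManifold 𝓘(ℝ, E) ∞ M]
  {g : ContMDiffRiemannianMetric 𝓘(ℝ, E) ∞ E (fun x : M ↦ TangentSpace 𝓘(ℝ, E) x)}
  {X Y : Π x : M, TangentSpace 𝓘(ℝ, E) x}

namespace AlmostContactMetricStructure

theorem contMDiff_φ_apply (S : AlmostContactMetricStructure g) (hX : CMDiff ∞ (T% X)) :
    CMDiff ∞ (T% (fun y ↦ S.φ y (X y))) :=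
  S.contMDiff_φ.clm_bundle_apply hX

theorem inner_ζ_left (S : AlmostContactMetricStructure g) (x : M) (v : TangentSpace 𝓘(ℝ, E) x) :
    g.inner x (S.ζ x) v = S.η x v := by
  rw [g.symm, S.inner_ζ]

variable [FiniteDimensional ℝ E] {S : AlmostContactMetricStructure g}

namespace IsSasakian

theorem mlieBracket_ζ (hS : S.IsSasakian) (hX : CMDiff ∞ (T% X)) (x : M) :
    mlieBracket 𝓘(ℝ, E) S.ζ X x = nabla g S.ζ X x + S.φ x (X x) := by
  rw [← nabla_sub_nabla g (mdifferentiableAt_of_contMDiff S.contMDiff_ζ x)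
    (mdifferentiableAt_of_contMDiff hX x), hS.nabla_ζ X hX, sub_neg_eq_add]

theorem nabla_φ_apply (hS : S.IsSasakian) (hX : CMDiff ∞ (T% X)) (hY : CMDiff ∞ (T% Y)) (x : M) :
    nabla g X (fun y ↦ S.φ y (Y y)) x =
      S.φ x (nabla g X Y x) + (g.inner x (X x) (Y x) • S.ζ x - S.η x (Y x) • X x) := by
  rw [← hS.nabla_φ X Y hX hY, add_sub_cancel]

variable [T2Space M]

theorem leviCivita_ζ_apply (hS : S.IsSasakian) {x : M} (v : TangentSpace 𝓘(ℝ, E) x) :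
    leviCivita g S.ζ x v = -S.φ x v := by
  obtain ⟨X, hX, rfl⟩ := exists_contMDiff_vectorField_apply_eq v
  exact hS.nabla_ζ X hX x

theorem inner_leviCivita_ζ (hS : S.IsSasakian) {x : M} (hX : MDiffAt (T% X) x)
    (hXη : ∀ y, S.η y (X y) = 0) (v : TangentSpace 𝓘(ℝ, E) x) :
    g.inner x (leviCivita g X x v) (S.ζ x) = -g.inner x (S.φ x (X x)) v := by
  obtain ⟨Y, hY, rfl⟩ := exists_contMDiff_vectorField_apply_eq v
  have horth := inner_nabla_of_orthogonal g (mdifferentiableAt_of_contMDiff hY x) hX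
    (mdifferentiableAt_of_contMDiff S.contMDiff_ζ x) fun y ↦ (S.inner_ζ y (X y)).trans (hXη y)
  rw [hS.nabla_ζ Y hY, map_neg, neg_neg] at horth
  rw [S.inner_φ, neg_neg, ← horth, nabla]

theorem lieMetric_apply_ζ (hS : S.IsSasakian) (hX : CMDiff ∞ (T% X))
    (hXη : ∀ y, S.η y (X y) = 0) {x : M} (v : TangentSpace 𝓘(ℝ, E) x) :
    lieMetric g X x v (S.ζ x) =
      g.inner x (mlieBracket 𝓘(ℝ, E) S.ζ X x) v - 2 * g.inner x (S.φ x (X x)) v := by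
  rw [lieMetric_apply, hS.inner_leviCivita_ζ (mdifferentiableAt_of_contMDiff hX x) hXη,
    hS.mlieBracket_ζ hX, map_add, add_apply, nabla, g.symm x v]
  ring

theorem lieMetric_ζ_ζ (hS : S.IsSasakian) {x : M} (hX : MDiffAt (T% X) x)
    (hXη : ∀ y, S.η y (X y) = 0) : lieMetric g X x (S.ζ x) (S.ζ x) = 0 := by
  rw [lieMetric_apply, g.symm x (S.ζ x), hS.inner_leviCivita_ζ hX hXη, S.inner_ζ, S.η_φ, neg_zero,
    add_zero]

theorem lieMetric_ζ (hS : S.IsSasakian) (x : M) : lieMetric g S.ζ x = 0 := by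
  ext v w
  rw [lieMetric_apply, hS.leviCivita_ζ_apply, hS.leviCivita_ζ_apply, map_neg, neg_apply,
    S.inner_φ, map_neg, neg_neg, add_neg_cancel, LinearMap.zero_apply, LinearMap.zero_apply]

end IsSasakian

end AlmostContactMetricStructure

end Sasakian

section LogDerivative

variable {E : Type*} [NormedAddCommGroup E] [NormedSpace ℝ E]
  {M : Type*} [TopologicalSpace M] [ChartedSpace E M]

theorem mvfderiv_sq_eq_mvfderiv_log {f : M → ℝ} {x : M} (hf : MDiffAt (fun y ↦ f y ^ 2) x)
    (hfx : f x ≠ 0) (v : TangentSpace 𝓘(ℝ, E) x) :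
    d% (fun y ↦ f y ^ 2) x v = 2 * (f x ^ 2 * d% (fun y ↦ Real.log (f y)) x v) := by
  have hne : f x ^ 2 ≠ 0 := pow_ne_zero 2 hfx
  have hlog : (fun y ↦ Real.log (f y)) = (fun t ↦ 2⁻¹ * Real.log t) ∘ fun y ↦ f y ^ 2 := by
    funext y
    simp
  have hderiv : HasDerivAt (fun t : ℝ ↦ 2⁻¹ * Real.log t) (2⁻¹ * (f x ^ 2)⁻¹) (f x ^ 2) :=
    (Real.hasDerivAt_log hne).const_mul _
  have hchain : d% (fun y ↦ Real.log (f y)) x v =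
      d% (fun y ↦ f y ^ 2) x v * (2⁻¹ * (f x ^ 2)⁻¹) := by
    rw [hlog, mvfderiv_comp_apply x hderiv.differentiableAt.mdifferentiableAt hf]
    change mfderiv 𝓘(ℝ, ℝ) 𝓘(ℝ, ℝ) (fun t : ℝ ↦ 2⁻¹ * Real.log t) (f x ^ 2)
      (d% (fun y ↦ f y ^ 2) x v) = _
    rw [mfderiv_eq_fderiv, hderiv.hasFDerivAt.fderiv]
    rfl
  rw [hchain]
  field_simp

end LogDerivative

section ConformalSubmersion

variable {E : Type*} [NormedAddCommGroup E] [NormedSpace ℝ E] [FiniteDimensional ℝ E]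
  {M : Type*} [TopologicalSpace M] [ChartedSpace E M] [IsManifold 𝓘(ℝ, E) ∞ M]
  {E' : Type*} [NormedAddCommGroup E'] [NormedSpace ℝ E'] [FiniteDimensional ℝ E']
  {N : Type*} [TopologicalSpace N] [ChartedSpace E' N] [IsManifold 𝓘(ℝ, E') ∞ N]
  {g : ContMDiffRiemannianMetric 𝓘(ℝ, E) ∞ E (fun x : M ↦ TangentSpace 𝓘(ℝ, E) x)}
  {h : ContMDiffRiemannianMetric 𝓘(ℝ, E') ∞ E' (fun y : N ↦ TangentSpace 𝓘(ℝ, E') y)}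
  {Ψ : M → N} {lam : M → ℝ} {U V X Y Z : Π x : M, TangentSpace 𝓘(ℝ, E) x} {x : M}

namespace IsConformalSubmersion

omit [FiniteDimensional ℝ E] [FiniteDimensional ℝ E'] in
theorem contMDiffAt_two (hc : IsConformalSubmersion g h Ψ lam) (x : M) : CMDiffAt 2 Ψ x :=
  (hc.contMDiff x).of_le (WithTop.coe_le_coe.2 le_top)

omit [FiniteDimensional ℝ E'] in
theorem pullbackForm_eq (hc : IsConformalSubmersion g h Ψ lam)
    (hY : ∀ y, Y y ∈ hor g 𝓘(ℝ, E') Ψ y) :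
    pullbackForm h Ψ X Y = fun y ↦ lam y ^ 2 * g.inner y (X y) (Y y) := by
  funext y
  rw [pullbackForm, ← mfderiv_hProj g (X y), hc.conformal y _ (hProj_mem g _) _ (hY y),
    inner_hProj_left g _ (hY y)]

omit [FiniteDimensional ℝ E] in
theorem pullbackNabla_vert (hc : IsConformalSubmersion g h Ψ lam)
    (hU : ∀ y, U y ∈ vert 𝓘(ℝ, E) 𝓘(ℝ, E') Ψ y) (v : TangentSpace 𝓘(ℝ, E) x) :
    pullbackNabla h Ψ (fun y ↦ mfderiv 𝓘(ℝ, E) 𝓘(ℝ, E') Ψ y (U y)) x v = 0 := by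
  rw [funext fun y ↦ mem_vert.1 (hU y)]
  exact pullbackNabla_zero h hc.contMDiff.continuous.continuousAt v

theorem mlieBracket_mem_vert (hc : IsConformalSubmersion g h Ψ lam)
    (hU : IsSection (vert 𝓘(ℝ, E) 𝓘(ℝ, E') Ψ) U) (hV : IsSection (vert 𝓘(ℝ, E) 𝓘(ℝ, E') Ψ) V)
    (x : M) : mlieBracket 𝓘(ℝ, E) U V x ∈ vert 𝓘(ℝ, E) 𝓘(ℝ, E') Ψ x := by
  rw [mem_vert, ← pullbackNabla_mfderiv_sub h (hc.contMDiffAt_two x)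
    (mdifferentiableAt_of_contMDiff hU.1 x) (mdifferentiableAt_of_contMDiff hV.1 x),
    hc.pullbackNabla_vert hU.2, hc.pullbackNabla_vert hV.2, sub_zero]

theorem mvfderiv_pullbackForm_vert (hc : IsConformalSubmersion g h Ψ lam)
    (hU : IsSection (vert 𝓘(ℝ, E) 𝓘(ℝ, E') Ψ) U) (hX : MDiffAt (T% X) x)
    (hY : MDiffAt (T% Y) x) :
    d% (pullbackForm h Ψ X Y) x (U x) = pullbackForm h Ψ (mlieBracket 𝓘(ℝ, E) U X) Y x
      + pullbackForm h Ψ X (mlieBracket 𝓘(ℝ, E) U Y) x := by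
  have hΨ := hc.contMDiffAt_two x
  have hbracket {A : Π x : M, TangentSpace 𝓘(ℝ, E) x} (hA : MDiffAt (T% A) x) :=
    pullbackNabla_mfderiv_sub h hΨ (mdifferentiableAt_of_contMDiff hU.1 x) hA
  simp only [hc.pullbackNabla_vert hU.2, sub_zero] at hbracket
  unfold pullbackForm
  rw [mvfderiv_inner_pullback h (hΨ.mdifferentiableAt (by simp))
    (mdifferentiableAt_pullbackCoord_mfderiv hΨ hX) (mdifferentiableAt_pullbackCoord_mfderiv hΨ hY),
    hbracket hX, hbracket hY]

theorem inner_pullbackNabla (hc : IsConformalSubmersion g h Ψ lam)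
    (hlam : MDiffAt (fun y ↦ lam y ^ 2) x)
    (hX : IsSection (hor g 𝓘(ℝ, E') Ψ) X) (hY : IsSection (hor g 𝓘(ℝ, E') Ψ) Y)
    (hZ : IsSection (hor g 𝓘(ℝ, E') Ψ) Z) :
    h.inner (Ψ x) (pullbackNabla h Ψ (fun y ↦ mfderiv 𝓘(ℝ, E) 𝓘(ℝ, E') Ψ y (Z y)) x (X x))
        (mfderiv 𝓘(ℝ, E) 𝓘(ℝ, E') Ψ x (Y x)) =
      lam x ^ 2 * g.inner x (nabla g X Z x) (Y x)
        + 1 / 2 * (d% (fun y ↦ lam y ^ 2) x (X x) * g.inner x (Z x) (Y x)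
          + d% (fun y ↦ lam y ^ 2) x (Z x) * g.inner x (X x) (Y x)
          - d% (fun y ↦ lam y ^ 2) x (Y x) * g.inner x (X x) (Z x)) := by
  have hXx := mdifferentiableAt_of_contMDiff hX.1 x
  have hYx := mdifferentiableAt_of_contMDiff hY.1 x
  have hZx := mdifferentiableAt_of_contMDiff hZ.1 x
  have hkoszul : g.inner x (nabla g X Z x) (Y x) = koszul g X Z Y x :=
    inner_leviCivitaFun g hXx hZx hYx
  have hpullback := two_inner_pullbackNabla h (hc.contMDiffAt_two x) hXx hYx hZx
  rw [hc.pullbackForm_eq hY.2, hc.pullbackForm_eq hY.2, hc.pullbackForm_eq hZ.2,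
    hc.pullbackForm_eq hY.2, hc.pullbackForm_eq hZ.2, hc.pullbackForm_eq hX.2,
    mvfderiv_fun_mul hlam (mdiff_metric g hZx hYx), mvfderiv_fun_mul hlam (mdiff_metric g hXx hYx),
    mvfderiv_fun_mul hlam (mdiff_metric g hXx hZx)] at hpullback
  simp only [add_apply, smul_apply, smul_eq_mul] at hpullback
  rw [hkoszul, koszul]
  linear_combination (1 / 2) * hpullback

variable [T2Space M]

theorem exists_vert_section (hc : IsConformalSubmersion g h Ψ lam)
    {v : TangentSpace 𝓘(ℝ, E) x} (hv : v ∈ vert 𝓘(ℝ, E) 𝓘(ℝ, E') Ψ x) :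
    ∃ V, IsSection (vert 𝓘(ℝ, E) 𝓘(ℝ, E') Ψ) V ∧ V x = v := by
  obtain ⟨X, hX, rfl⟩ := exists_contMDiff_vectorField_apply_eq v
  exact ⟨fun y ↦ vProj g 𝓘(ℝ, E') Ψ y (X y),
    ⟨contMDiff_vProj g hc.contMDiff hc.surjective_mfderiv hX, fun y ↦ vProj_mem g _⟩,
    vProj_eq_self g hv⟩

theorem exists_hor_section (hc : IsConformalSubmersion g h Ψ lam)
    {v : TangentSpace 𝓘(ℝ, E) x} (hv : v ∈ hor g 𝓘(ℝ, E') Ψ x) :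
    ∃ V, IsSection (hor g 𝓘(ℝ, E') Ψ) V ∧ V x = v := by
  obtain ⟨X, hX, rfl⟩ := exists_contMDiff_vectorField_apply_eq v
  exact ⟨fun y ↦ hProj g 𝓘(ℝ, E') Ψ y (X y),
    ⟨contMDiff_hProj g hc.contMDiff hc.surjective_mfderiv hX, fun y ↦ hProj_mem g _⟩,
    hProj_eq_self g hv⟩

theorem sq_mul_lieMetric_vert (hc : IsConformalSubmersion g h Ψ lam)
    (hlam : MDiffAt (fun y ↦ lam y ^ 2) x) (hU : IsSection (vert 𝓘(ℝ, E) 𝓘(ℝ, E') Ψ) U)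
    {v w : TangentSpace 𝓘(ℝ, E) x} (hv : v ∈ hor g 𝓘(ℝ, E') Ψ x) (hw : w ∈ hor g 𝓘(ℝ, E') Ψ x) :
    lam x ^ 2 * lieMetric g U x v w = -(d% (fun y ↦ lam y ^ 2) x (U x) * g.inner x v w) := by
  obtain ⟨X, hX, rfl⟩ := hc.exists_hor_section hv
  obtain ⟨Y, hY, rfl⟩ := hc.exists_hor_section hw
  have hXx := mdifferentiableAt_of_contMDiff hX.1 x
  have hYx := mdifferentiableAt_of_contMDiff hY.1 x
  have hinvariant := hc.mvfderiv_pullbackForm_vert hU hXx hYx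
  rw [pullbackForm_comm h X (mlieBracket 𝓘(ℝ, E) U Y), hc.pullbackForm_eq hY.2,
    hc.pullbackForm_eq hY.2, hc.pullbackForm_eq hX.2,
    mvfderiv_fun_mul hlam (mdiff_metric g hXx hYx)] at hinvariant
  simp only [add_apply, smul_apply, smul_eq_mul, mvfderiv_inner_eq_lieMetric g
    (mdifferentiableAt_of_contMDiff hU.1 x) hXx hYx, g.symm x (X x) (mlieBracket _ _ _ _)]
    at hinvariant
  linarith

end IsConformalSubmersion

end ConformalSubmersion

section Distributions

variable {E : Type*} [NormedAddCommGroup E] [NormedSpace ℝ E]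
  {H : Type*} [TopologicalSpace H] {I : ModelWithCorners ℝ E H}
  {M : Type*} [TopologicalSpace M] [ChartedSpace H M] [IsManifold I ∞ M]
  {g : ContMDiffRiemannianMetric I ∞ E (fun x : M ↦ TangentSpace I x)}
  {E' : Type*} [NormedAddCommGroup E'] [NormedSpace ℝ E']
  {H' : Type*} [TopologicalSpace H'] {J : ModelWithCorners ℝ E' H'}
  {N : Type*} [TopologicalSpace N] [ChartedSpace H' N]
  {S : AlmostContactMetricStructure g} {Ψ : M → N}
  {D₁ : Π x : M, Submodule ℝ (TangentSpace I x)} {x : M}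

theorem mem_distMu {v : TangentSpace I x} :
    v ∈ distMu J S Ψ D₁ x ↔ v ∈ hor g J Ψ x ∧
      ∀ w ∈ distD₂ g J Ψ D₁ x, g.inner x (S.φ x w) v = 0 := by
  rw [distMu, Submodule.mem_inf, mem_orth]
  refine and_congr_right fun _ ↦ ⟨fun hv w hw ↦ hv _ (Submodule.mem_map_of_mem hw), ?_⟩
  rintro hv _ ⟨w, hw, rfl⟩
  exact hv w hw

theorem distD₂_eq_vert (hD : ∀ x, D₁ x = ⊥) (x : M) :
    distD₂ g J Ψ D₁ x = vert I J Ψ x := by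
  refine inf_eq_left.2 fun v _ ↦ (mem_orth g).2 fun w hw ↦ ?_
  rw [hD, Submodule.mem_bot] at hw
  rw [hw, map_zero, zero_apply]

theorem mem_distMu_iff_φ_mem_hor (hD : ∀ x, D₁ x = ⊥) {v : TangentSpace I x} :
    v ∈ distMu J S Ψ D₁ x ↔ v ∈ hor g J Ψ x ∧ S.φ x v ∈ hor g J Ψ x := by
  rw [mem_distMu, distD₂_eq_vert hD, hor, mem_orth g (v := S.φ x v)]
  simp only [S.inner_φ x _ v, neg_eq_zero]

theorem inner_φ_mu (hD : ∀ x, D₁ x = ⊥) {v w : TangentSpace I x}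
    (hv : v ∈ vert I J Ψ x) (hw : w ∈ distMu J S Ψ D₁ x) :
    g.inner x (S.φ x v) w = 0 :=
  (mem_distMu.1 hw).2 v (by rwa [distD₂_eq_vert hD])

end Distributions

section SemiInvariant

variable {E : Type*} [NormedAddCommGroup E] [NormedSpace ℝ E]
  {M : Type*} [TopologicalSpace M] [ChartedSpace E M] [IsManifold 𝓘(ℝ, E) ∞ M]
  {E' : Type*} [NormedAddCommGroup E'] [NormedSpace ℝ E']
  {N : Type*} [TopologicalSpace N] [ChartedSpace E' N] [IsManifold 𝓘(ℝ, E') ∞ N]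
  {g : ContMDiffRiemannianMetric 𝓘(ℝ, E) ∞ E (fun x : M ↦ TangentSpace 𝓘(ℝ, E) x)}
  {h : ContMDiffRiemannianMetric 𝓘(ℝ, E') ∞ E' (fun y : N ↦ TangentSpace 𝓘(ℝ, E') y)}
  {S : AlmostContactMetricStructure g} {Ψ : M → N} {lam : M → ℝ}
  {D₁ : Π x : M, Submodule ℝ (TangentSpace 𝓘(ℝ, E) x)}
  {U V X Z : Π x : M, TangentSpace 𝓘(ℝ, E) x} {x : M}

namespace IsSicSubmersion

section Algebra

theorem isSection_ζ (hΨ : IsSicSubmersion h S Ψ lam D₁) : IsSection (hor g 𝓘(ℝ, E') Ψ) S.ζ :=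
  ⟨S.contMDiff_ζ, hΨ.ζ_mem⟩

theorem η_vert (hΨ : IsSicSubmersion h S Ψ lam D₁) {v : TangentSpace 𝓘(ℝ, E) x}
    (hv : v ∈ vert 𝓘(ℝ, E) 𝓘(ℝ, E') Ψ x) : S.η x v = 0 := by
  rw [← S.inner_ζ, inner_vert_hor g hv (hΨ.ζ_mem x)]

theorem φ_mem_D₁ (hΨ : IsSicSubmersion h S Ψ lam D₁) {v : TangentSpace 𝓘(ℝ, E) x}
    (hv : v ∈ D₁ x) : S.φ x v ∈ D₁ x := by
  rw [← hΨ.map_D₁ x]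
  exact Submodule.mem_map_of_mem hv

theorem φ_mem_hor_of_mem_D₂ (hΨ : IsSicSubmersion h S Ψ lam D₁) {v : TangentSpace 𝓘(ℝ, E) x}
    (hv : v ∈ distD₂ g 𝓘(ℝ, E') Ψ D₁ x) : S.φ x v ∈ hor g 𝓘(ℝ, E') Ψ x :=
  hΨ.map_D₂ x (Submodule.mem_map_of_mem hv)

theorem isSection_mu_ζ (hΨ : IsSicSubmersion h S Ψ lam D₁) :
    IsSection (distMu 𝓘(ℝ, E') S Ψ D₁) S.ζ :=
  ⟨S.contMDiff_ζ, fun x ↦ mem_distMu.2 ⟨hΨ.ζ_mem x, fun w _ ↦ by rw [S.inner_ζ, S.η_φ]⟩⟩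

theorem eq_zero_of_inner_φ_self (hΨ : IsSicSubmersion h S Ψ lam D₁)
    {v : TangentSpace 𝓘(ℝ, E) x} (hv : v ∈ vert 𝓘(ℝ, E) 𝓘(ℝ, E') Ψ x)
    (hzero : g.inner x (S.φ x v) (S.φ x v) = 0) : v = 0 := by
  rw [S.inner_φ_φ, hΨ.η_vert hv, mul_zero, sub_zero] at hzero
  exact eq_zero_of_inner_self g hzero

variable [FiniteDimensional ℝ E]

theorem exists_D₁_add_D₂_eq (hΨ : IsSicSubmersion h S Ψ lam D₁) {v : TangentSpace 𝓘(ℝ, E) x}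
    (hv : v ∈ vert 𝓘(ℝ, E) 𝓘(ℝ, E') Ψ x) :
    ∃ d ∈ D₁ x, ∃ e ∈ distD₂ g 𝓘(ℝ, E') Ψ D₁ x, d + e = v := by
  have hsup : v ∈ D₁ x ⊔ orth g x (D₁ x) := by
    rw [(isCompl_orth g x (D₁ x)).sup_eq_top]
    exact Submodule.mem_top
  obtain ⟨d, hd, e, he, rfl⟩ := Submodule.mem_sup.1 hsup
  exact ⟨d, hd, e, ⟨(Submodule.add_mem_iff_right _ (hΨ.D₁_le x hd)).1 hv, he⟩, rfl⟩

theorem vProj_φ_mem_D₁ (hΨ : IsSicSubmersion h S Ψ lam D₁) {v : TangentSpace 𝓘(ℝ, E) x}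
    (hv : v ∈ vert 𝓘(ℝ, E) 𝓘(ℝ, E') Ψ x) : vProj g 𝓘(ℝ, E') Ψ x (S.φ x v) ∈ D₁ x := by
  obtain ⟨d, hd, e, he, rfl⟩ := hΨ.exists_D₁_add_D₂_eq hv
  rw [map_add, map_add, vProj_eq_self g (hΨ.D₁_le x (hΨ.φ_mem_D₁ hd)),
    vProj_eq_zero g (hΨ.φ_mem_hor_of_mem_D₂ he), add_zero]
  exact hΨ.φ_mem_D₁ hd

theorem φ_hProj_φ_mem_D₂ (hΨ : IsSicSubmersion h S Ψ lam D₁) {v : TangentSpace 𝓘(ℝ, E) x}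
    (hv : v ∈ vert 𝓘(ℝ, E) 𝓘(ℝ, E') Ψ x) :
    S.φ x (hProj g 𝓘(ℝ, E') Ψ x (S.φ x v)) ∈ distD₂ g 𝓘(ℝ, E') Ψ D₁ x := by
  obtain ⟨d, hd, e, he, rfl⟩ := hΨ.exists_D₁_add_D₂_eq hv
  have he' : hProj g 𝓘(ℝ, E') Ψ x (S.φ x e) = S.φ x e :=
    hProj_eq_self g (hΨ.φ_mem_hor_of_mem_D₂ he)
  rw [map_add, map_add, hProj_eq_zero g (hΨ.D₁_le x (hΨ.φ_mem_D₁ hd)), he', zero_add, S.φ_φ,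
    hΨ.η_vert he.1, zero_smul, add_zero]
  exact Submodule.neg_mem _ he

end Algebra

section Dilation

variable [FiniteDimensional ℝ E]

theorem pullbackForm_ζ (hΨ : IsSicSubmersion h S Ψ lam D₁) :
    pullbackForm h Ψ S.ζ S.ζ = fun y ↦ lam y ^ 2 := by
  rw [hΨ.pullbackForm_eq hΨ.ζ_mem]
  simp only [S.inner_ζ, S.η_ζ, mul_one]

theorem mdifferentiableAt_sq (hΨ : IsSicSubmersion h S Ψ lam D₁) (x : M) :
    MDiffAt (fun y ↦ lam y ^ 2) x := by
  have hζ := mdifferentiableAt_of_contMDiff S.contMDiff_ζ x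
  rw [← hΨ.pullbackForm_ζ]
  exact mdifferentiableAt_pullbackForm h (hΨ.contMDiffAt_two x) hζ hζ

theorem mvfderiv_sq (hΨ : IsSicSubmersion h S Ψ lam D₁) (v : TangentSpace 𝓘(ℝ, E) x) :
    d% (fun y ↦ lam y ^ 2) x v =
      2 * (lam x ^ 2 * g.inner x (grad g (fun y ↦ Real.log (lam y)) x) v) := by
  rw [mvfderiv_sq_eq_mvfderiv_log (hΨ.mdifferentiableAt_sq x) (hΨ.lam_pos x).ne', grad,
    inner_sharp, ContinuousLinearMap.coe_coe]

variable [FiniteDimensional ℝ E'] [T2Space M]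

theorem mvfderiv_sq_vert (hΨ : IsSicSubmersion h S Ψ lam D₁) (hS : S.IsSasakian)
    {v : TangentSpace 𝓘(ℝ, E) x} (hv : v ∈ vert 𝓘(ℝ, E) 𝓘(ℝ, E') Ψ x) :
    d% (fun y ↦ lam y ^ 2) x v = 0 := by
  obtain ⟨U, hU, rfl⟩ := hΨ.exists_vert_section hv
  have hlie := hΨ.sq_mul_lieMetric_vert (hΨ.mdifferentiableAt_sq x) hU (hΨ.ζ_mem x) (hΨ.ζ_mem x)
  rw [hS.lieMetric_ζ_ζ (mdifferentiableAt_of_contMDiff hU.1 x) fun y ↦ hΨ.η_vert (hU.2 y),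
    S.inner_ζ, S.η_ζ, mul_one, mul_zero] at hlie
  exact neg_eq_zero.1 hlie.symm

theorem lieMetric_vert (hΨ : IsSicSubmersion h S Ψ lam D₁) (hS : S.IsSasakian)
    (hU : IsSection (vert 𝓘(ℝ, E) 𝓘(ℝ, E') Ψ) U) {v w : TangentSpace 𝓘(ℝ, E) x}
    (hv : v ∈ hor g 𝓘(ℝ, E') Ψ x) (hw : w ∈ hor g 𝓘(ℝ, E') Ψ x) : lieMetric g U x v w = 0 := by
  have hlie := hΨ.sq_mul_lieMetric_vert (hΨ.mdifferentiableAt_sq x) hU hv hw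
  rw [hΨ.mvfderiv_sq_vert hS (hU.2 x), zero_mul, neg_zero] at hlie
  exact (mul_eq_zero.1 hlie).resolve_left (pow_pos (hΨ.lam_pos x) 2).ne'

end Dilation

section ReebBracket

variable [FiniteDimensional ℝ E] [FiniteDimensional ℝ E'] [T2Space M]

theorem inner_mlieBracket_ζ_hor (hΨ : IsSicSubmersion h S Ψ lam D₁) (hS : S.IsSasakian)
    (hU : IsSection (vert 𝓘(ℝ, E) 𝓘(ℝ, E') Ψ) U) {v : TangentSpace 𝓘(ℝ, E) x}
    (hv : v ∈ hor g 𝓘(ℝ, E') Ψ x) :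
    g.inner x (mlieBracket 𝓘(ℝ, E) S.ζ U x) v = 2 * g.inner x (S.φ x (U x)) v := by
  rw [← sub_eq_zero, ← hS.lieMetric_apply_ζ hU.1 fun y ↦ hΨ.η_vert (hU.2 y),
    hΨ.lieMetric_vert hS hU hv (hΨ.ζ_mem x)]

theorem inner_mlieBracket_ζ_vert (hΨ : IsSicSubmersion h S Ψ lam D₁) (hS : S.IsSasakian)
    (hX : IsSection (hor g 𝓘(ℝ, E') Ψ) X) {v : TangentSpace 𝓘(ℝ, E) x}
    (hv : v ∈ vert 𝓘(ℝ, E) 𝓘(ℝ, E') Ψ x) :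
    g.inner x (mlieBracket 𝓘(ℝ, E) S.ζ X x) v = -2 * g.inner x (S.φ x v) (X x) := by
  obtain ⟨V, hV, rfl⟩ := hΨ.exists_vert_section hv
  have hkilling := mvfderiv_inner_eq_lieMetric g (mdifferentiableAt_of_contMDiff S.contMDiff_ζ x)
    (mdifferentiableAt_of_contMDiff hX.1 x) (mdifferentiableAt_of_contMDiff hV.1 x)
  rw [funext fun y ↦ inner_hor_vert g (hX.2 y) (hV.2 y), mvfderiv_const, zero_apply,
    hS.lieMetric_ζ, LinearMap.zero_apply, LinearMap.zero_apply, g.symm x (X x),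
    hΨ.inner_mlieBracket_ζ_hor hS hV (hX.2 x)] at hkilling
  linarith

theorem isSection_mlieBracket_ζ_vert (hΨ : IsSicSubmersion h S Ψ lam D₁) (hS : S.IsSasakian)
    (hU : IsSection (vert 𝓘(ℝ, E) 𝓘(ℝ, E') Ψ) U) :
    IsSection (vert 𝓘(ℝ, E) 𝓘(ℝ, E') Ψ)
      (mlieBracket 𝓘(ℝ, E) S.ζ U + (-2 : ℝ) • fun y ↦ S.φ y (U y)) := by
  refine ⟨(contMDiff_mlieBracket S.contMDiff_ζ hU.1).add_section
    (S.contMDiff_φ_apply hU.1).const_smul_section, fun x ↦ mem_vert_of_inner_hor g fun w hw ↦ ?_⟩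
  simp only [Pi.add_apply, Pi.smul_apply, map_add, map_smul, add_apply, smul_apply, smul_eq_mul,
    hΨ.inner_mlieBracket_ζ_hor hS hU hw]
  ring

end ReebBracket

section AntiInvariant

theorem φ_mem_hor (hΨ : IsSicSubmersion h S Ψ lam D₁) (hD : ∀ x, D₁ x = ⊥)
    {v : TangentSpace 𝓘(ℝ, E) x} (hv : v ∈ vert 𝓘(ℝ, E) 𝓘(ℝ, E') Ψ x) :
    S.φ x v ∈ hor g 𝓘(ℝ, E') Ψ x :=
  hΨ.φ_mem_hor_of_mem_D₂ (by rwa [distD₂_eq_vert hD])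

theorem isSection_φ (hΨ : IsSicSubmersion h S Ψ lam D₁) (hD : ∀ x, D₁ x = ⊥)
    (hV : IsSection (vert 𝓘(ℝ, E) 𝓘(ℝ, E') Ψ) V) :
    IsSection (hor g 𝓘(ℝ, E') Ψ) fun y ↦ S.φ y (V y) :=
  ⟨S.contMDiff_φ_apply hV.1, fun x ↦ hΨ.φ_mem_hor hD (hV.2 x)⟩

variable [FiniteDimensional ℝ E] [FiniteDimensional ℝ E'] [T2Space M]

theorem mlieBracket_ζ_mem_hor (hΨ : IsSicSubmersion h S Ψ lam D₁) (hS : S.IsSasakian)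
    (hD : ∀ x, D₁ x = ⊥) (hZ : IsSection (distMu 𝓘(ℝ, E') S Ψ D₁) Z) (x : M) :
    mlieBracket 𝓘(ℝ, E) S.ζ Z x ∈ hor g 𝓘(ℝ, E') Ψ x := by
  refine (mem_orth g).2 fun w hw ↦ ?_
  rw [g.symm, hΨ.inner_mlieBracket_ζ_vert hS ⟨hZ.1, fun y ↦ (hZ.2 y).1⟩ hw,
    inner_φ_mu hD hw (hZ.2 x), mul_zero]

theorem mlieBracket_ζ_φ_add_mem_hor (hΨ : IsSicSubmersion h S Ψ lam D₁) (hS : S.IsSasakian)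
    (hD : ∀ x, D₁ x = ⊥) (hV : IsSection (vert 𝓘(ℝ, E) 𝓘(ℝ, E') Ψ) V) (x : M) :
    mlieBracket 𝓘(ℝ, E) S.ζ (fun y ↦ S.φ y (V y)) x + (2 : ℝ) • V x ∈ hor g 𝓘(ℝ, E') Ψ x := by
  refine (mem_orth g).2 fun w hw ↦ ?_
  rw [g.symm, map_add, add_apply, hΨ.inner_mlieBracket_ζ_vert hS (hΨ.isSection_φ hD hV) hw,
    S.inner_φ_φ, hΨ.η_vert hw, map_smul, smul_apply, smul_eq_mul, g.symm x (V x)]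
  ring

/-- Both sides are half of `(L_{[ζ, U]} g)(Z, φ V)`: on the left because `[ζ, U] - 2 φ U` is
vertical, on the right because `L_{[ζ, U]} = [L_ζ, L_U]` and `ζ` is a Killing field. -/
theorem lieMetric_φ (hΨ : IsSicSubmersion h S Ψ lam D₁) (hS : S.IsSasakian)
    (hD : ∀ x, D₁ x = ⊥) (hU : IsSection (vert 𝓘(ℝ, E) 𝓘(ℝ, E') Ψ) U)
    (hV : IsSection (vert 𝓘(ℝ, E) 𝓘(ℝ, E') Ψ) V) (hZ : IsSection (distMu 𝓘(ℝ, E') S Ψ D₁) Z)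
    (x : M) :
    lieMetric g (fun y ↦ S.φ y (U y)) x (Z x) (S.φ x (V x)) = lieMetric g U x (Z x) (V x) := by
  have hφU := mdifferentiableAt_of_contMDiff (S.contMDiff_φ_apply hU.1) x
  have hφV := hΨ.isSection_φ hD hV
  have hbracket := mdifferentiableAt_of_contMDiff (contMDiff_mlieBracket S.contMDiff_ζ hU.1) x
  have hleft : lieMetric g (mlieBracket 𝓘(ℝ, E) S.ζ U) x (Z x) (S.φ x (V x)) =
      2 * lieMetric g (fun y ↦ S.φ y (U y)) x (Z x) (S.φ x (V x)) := by
    have hvert := hΨ.lieMetric_vert hS (hΨ.isSection_mlieBracket_ζ_vert hS hU) (hZ.2 x).1 (hφV.2 x)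
    rw [lieMetric_add g hbracket
      (mdifferentiableAt_of_contMDiff (S.contMDiff_φ_apply hU.1).const_smul_section x),
      lieMetric_const_smul g _ hφU] at hvert
    simp only [LinearMap.add_apply, LinearMap.smul_apply, smul_eq_mul] at hvert
    linarith
  have hright : lieMetric g (mlieBracket 𝓘(ℝ, E) S.ζ U) x (Z x) (S.φ x (V x)) =
      2 * lieMetric g U x (Z x) (V x) := by
    have hhor := hΨ.lieMetric_vert hS hU (hZ.2 x).1 (hΨ.mlieBracket_ζ_φ_add_mem_hor hS hD hV x)
    rw [map_add, map_smul, smul_eq_mul] at hhor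
    rw [lieMetric_mlieBracket g S.contMDiff_ζ hU.1 hZ.1 hφV.1,
      funext fun y ↦ hΨ.lieMetric_vert hS hU (hZ.2 y).1 (hφV.2 y),
      hΨ.lieMetric_vert hS hU (hΨ.mlieBracket_ζ_mem_hor hS hD hZ x) (hφV.2 x)]
    simp only [hS.lieMetric_ζ, LinearMap.zero_apply, mvfderiv_const, zero_apply]
    linarith
  linarith

theorem inner_nabla_φ (hΨ : IsSicSubmersion h S Ψ lam D₁) (hS : S.IsSasakian)
    (hD : ∀ x, D₁ x = ⊥) (hU : IsSection (vert 𝓘(ℝ, E) 𝓘(ℝ, E') Ψ) U)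
    (hV : IsSection (vert 𝓘(ℝ, E) 𝓘(ℝ, E') Ψ) V) (hZ : IsSection (distMu 𝓘(ℝ, E') S Ψ D₁) Z)
    (x : M) :
    g.inner x (nabla g (fun y ↦ S.φ y (V y)) Z x) (S.φ x (U x)) =
      -g.inner x (nabla g U V x) (Z x) := by
  have hUx := mdifferentiableAt_of_contMDiff hU.1 x
  have hVx := mdifferentiableAt_of_contMDiff hV.1 x
  have hφ : g.inner x (nabla g Z (fun y ↦ S.φ y (U y)) x) (S.φ x (V x)) =
      g.inner x (nabla g Z U x) (V x) := by
    rw [hS.nabla_φ_apply hZ.1 hU.1, inner_hor_vert g (hZ.2 x).1 (hU.2 x), hΨ.η_vert (hU.2 x),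
      zero_smul, zero_smul, sub_zero, add_zero, S.inner_φ_φ, hΨ.η_vert (hV.2 x), mul_zero, sub_zero]
  have hlie : g.inner x (Z x) (nabla g (fun y ↦ S.φ y (V y)) (fun y ↦ S.φ y (U y)) x) =
      g.inner x (Z x) (nabla g V U x) := by
    have hLie := hΨ.lieMetric_φ hS hD hU hV hZ x
    rw [lieMetric_apply, lieMetric_apply] at hLie
    exact add_left_cancel (hLie.trans (congrArg (· + _) hφ.symm))
  have hsymm : g.inner x (Z x) (nabla g V U x) = g.inner x (Z x) (nabla g U V x) := by
    rw [← sub_eq_zero, ← map_sub, nabla_sub_nabla g hVx hUx,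
      inner_hor_vert g (hZ.2 x).1 (hΨ.mlieBracket_mem_vert hV hU x)]
  rw [inner_nabla_of_orthogonal g
    (mdifferentiableAt_of_contMDiff (S.contMDiff_φ_apply hV.1) x)
    (mdifferentiableAt_of_contMDiff hZ.1 x)
    (mdifferentiableAt_of_contMDiff (S.contMDiff_φ_apply hU.1) x)
    (fun y ↦ by rw [g.symm, inner_φ_mu hD (hU.2 y) (hZ.2 y)]), hlie, hsymm, g.symm]

end AntiInvariant

end IsSicSubmersion

end SemiInvariant

section Tensors

variable {E : Type*} [NormedAddCommGroup E] [NormedSpace ℝ E] [FiniteDimensional ℝ E]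
  {H : Type*} [TopologicalSpace H] {I : ModelWithCorners ℝ E H}
  {M : Type*} [TopologicalSpace M] [ChartedSpace H M] [IsManifold I ∞ M]
  (g : ContMDiffRiemannianMetric I ∞ E (fun x : M ↦ TangentSpace I x))
  {E' : Type*} [NormedAddCommGroup E'] [NormedSpace ℝ E']
  {H' : Type*} [TopologicalSpace H'] {J : ModelWithCorners ℝ E' H'}
  {N : Type*} [TopologicalSpace N] [ChartedSpace H' N]
  {Ψ : M → N} {X Y : Π x : M, TangentSpace I x} {x : M}

theorem vProj_eq_zero_iff {v : TangentSpace I x} : vProj g J Ψ x v = 0 ↔ v ∈ hor g J Ψ x := by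
  refine ⟨fun hv ↦ ?_, vProj_eq_zero g⟩
  rw [← vProj_add_hProj g (J := J) (Ψ := Ψ) v, hv, zero_add]
  exact hProj_mem g v

theorem oneillT_zero : oneillT g J Ψ X (fun _ ↦ 0) x = 0 := by
  simp only [oneillT, map_zero, nabla_zero, add_zero]

theorem oneillT_of_mem_vert_of_mem_hor (hX : ∀ y, X y ∈ vert I J Ψ y)
    (hY : ∀ y, Y y ∈ hor g J Ψ y) :
    oneillT g J Ψ X Y x = vProj g J Ψ x (nabla g X Y x) := by
  rw [oneillT, funext fun y ↦ vProj_eq_self g (hX y), funext fun y ↦ vProj_eq_zero g (hY y),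
    funext fun y ↦ hProj_eq_self g (hY y), nabla_zero, map_zero, zero_add]

theorem inner_oneillA (hX : ∀ y, X y ∈ hor g J Ψ y) (hY : ∀ y, Y y ∈ vert I J Ψ y)
    {v : TangentSpace I x} (hv : v ∈ hor g J Ψ x) :
    g.inner x (oneillA g J Ψ X Y x) v = g.inner x (nabla g X Y x) v := by
  rw [oneillA, funext fun y ↦ hProj_eq_self g (hX y), funext fun y ↦ vProj_eq_self g (hY y),
    map_add, add_apply, inner_hProj_left g _ hv, inner_vert_hor g (vProj_mem g _) hv, add_zero]

end Tensors

section FundamentalEquivalence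

variable {E : Type*} [NormedAddCommGroup E] [NormedSpace ℝ E] [FiniteDimensional ℝ E]
  {M : Type*} [TopologicalSpace M] [ChartedSpace E M] [IsManifold 𝓘(ℝ, E) ∞ M]
  {E' : Type*} [NormedAddCommGroup E'] [NormedSpace ℝ E']
  {N : Type*} [TopologicalSpace N] [ChartedSpace E' N] [IsManifold 𝓘(ℝ, E') ∞ N]
  {g : ContMDiffRiemannianMetric 𝓘(ℝ, E) ∞ E (fun x : M ↦ TangentSpace 𝓘(ℝ, E) x)}
  {h : ContMDiffRiemannianMetric 𝓘(ℝ, E') ∞ E' (fun y : N ↦ TangentSpace 𝓘(ℝ, E') y)}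
  {S : AlmostContactMetricStructure g} {Ψ : M → N} {lam : M → ℝ}
  {D₁ : Π x : M, Submodule ℝ (TangentSpace 𝓘(ℝ, E) x)}
  {U V X Z : Π x : M, TangentSpace 𝓘(ℝ, E) x} {x : M}

variable (h S Ψ lam) in
/-- The condition on `∇^Ψ` and the tensors `T` and `A` that relates the fields `U`, `V`, `Z` at
the point `x`. -/
def PullbackCondition [FiniteDimensional ℝ E'] (U V Z : Π x : M, TangentSpace 𝓘(ℝ, E) x) (x : M) :
    Prop :=
  h.inner (Ψ x)
    (pullbackNabla h Ψ (fun y ↦ mfderiv 𝓘(ℝ, E) 𝓘(ℝ, E') Ψ y (Z y)) x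
      (horPart 𝓘(ℝ, E') S Ψ V x))
    (mfderiv 𝓘(ℝ, E) 𝓘(ℝ, E') Ψ x (horPart 𝓘(ℝ, E') S Ψ U x))
  = lam x ^ 2 * g.inner x
    (horPart 𝓘(ℝ, E') S Ψ (oneillT g 𝓘(ℝ, E') Ψ U (vertPart 𝓘(ℝ, E') S Ψ V)) x
      + oneillA g 𝓘(ℝ, E') Ψ (horPart 𝓘(ℝ, E') S Ψ V) (vertPart 𝓘(ℝ, E') S Ψ U) x
      + g.inner x (horPart 𝓘(ℝ, E') S Ψ V x) (horPart 𝓘(ℝ, E') S Ψ U x)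
        • grad g (fun y ↦ Real.log (lam y)) x
      - g.inner x (vertPart 𝓘(ℝ, E') S Ψ U x) (V x) • S.ζ x)
    (Z x)

namespace IsSicSubmersion

section Parts

theorem inner_horPart_ζ (hΨ : IsSicSubmersion h S Ψ lam D₁) (x : M) :
    g.inner x (horPart 𝓘(ℝ, E') S Ψ X x) (S.ζ x) = 0 := by
  rw [horPart, inner_hProj_left g _ (hΨ.ζ_mem x), S.inner_ζ, S.η_φ]

theorem vertPart_eq_zero (hΨ : IsSicSubmersion h S Ψ lam D₁) (hD : ∀ x, D₁ x = ⊥)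
    (hV : ∀ y, V y ∈ vert 𝓘(ℝ, E) 𝓘(ℝ, E') Ψ y) : vertPart 𝓘(ℝ, E') S Ψ V = fun _ ↦ 0 :=
  funext fun y ↦ vProj_eq_zero g (hΨ.φ_mem_hor hD (hV y))

theorem horPart_eq (hΨ : IsSicSubmersion h S Ψ lam D₁) (hD : ∀ x, D₁ x = ⊥)
    (hV : ∀ y, V y ∈ vert 𝓘(ℝ, E) 𝓘(ℝ, E') Ψ y) :
    horPart 𝓘(ℝ, E') S Ψ V = fun y ↦ S.φ y (V y) :=
  funext fun y ↦ hProj_eq_self g (hΨ.φ_mem_hor hD (hV y))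

variable [FiniteDimensional ℝ E']

theorem isSection_vertPart (hΨ : IsSicSubmersion h S Ψ lam D₁) (hX : CMDiff ∞ (T% X)) :
    IsSection (vert 𝓘(ℝ, E) 𝓘(ℝ, E') Ψ) (vertPart 𝓘(ℝ, E') S Ψ X) :=
  ⟨contMDiff_vProj g hΨ.contMDiff hΨ.surjective_mfderiv (S.contMDiff_φ_apply hX),
    fun _ ↦ vProj_mem g _⟩

theorem isSection_horPart (hΨ : IsSicSubmersion h S Ψ lam D₁) (hX : CMDiff ∞ (T% X)) :
    IsSection (hor g 𝓘(ℝ, E') Ψ) (horPart 𝓘(ℝ, E') S Ψ X) :=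
  ⟨contMDiff_hProj g hΨ.contMDiff hΨ.surjective_mfderiv (S.contMDiff_φ_apply hX),
    fun _ ↦ hProj_mem g _⟩

end Parts

section Mu

theorem mem_vert_iff_inner_mu (hΨ : IsSicSubmersion h S Ψ lam D₁) (hD : ∀ x, D₁ x = ⊥)
    {v : TangentSpace 𝓘(ℝ, E) x} :
    v ∈ vert 𝓘(ℝ, E) 𝓘(ℝ, E') Ψ x ↔
      S.φ x v ∈ hor g 𝓘(ℝ, E') Ψ x ∧ ∀ w ∈ distMu 𝓘(ℝ, E') S Ψ D₁ x, g.inner x v w = 0 := by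
  refine ⟨fun hv ↦ ⟨hΨ.φ_mem_hor hD hv, fun w hw ↦ inner_vert_hor g hv hw.1⟩,
    fun ⟨hφv, hmu⟩ ↦ ?_⟩
  have hsplit := vProj_add_hProj g (J := 𝓘(ℝ, E')) (Ψ := Ψ) v
  have hhor : S.φ x (hProj g 𝓘(ℝ, E') Ψ x v) ∈ hor g 𝓘(ℝ, E') Ψ x := by
    rw [← hsplit, map_add] at hφv
    exact (Submodule.add_mem_iff_right _ (hΨ.φ_mem_hor hD (vProj_mem g v))).1 hφv
  have hzero : hProj g 𝓘(ℝ, E') Ψ x v = 0 := eq_zero_of_inner_self g <| by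
    rw [inner_hProj_left g v (hProj_mem g v)]
    exact hmu _ ((mem_distMu_iff_φ_mem_hor hD).2 ⟨hProj_mem g v, hhor⟩)
  rw [← hsplit, hzero, add_zero]
  exact vProj_mem g v

variable [FiniteDimensional ℝ E'] [T2Space M]

theorem exists_mu_section (hΨ : IsSicSubmersion h S Ψ lam D₁) (hD : ∀ x, D₁ x = ⊥)
    {v : TangentSpace 𝓘(ℝ, E) x} (hv : v ∈ distMu 𝓘(ℝ, E') S Ψ D₁ x) :
    ∃ Z, IsSection (distMu 𝓘(ℝ, E') S Ψ D₁) Z ∧ Z x = v := by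
  obtain ⟨hhor, hφv⟩ := (mem_distMu_iff_φ_mem_hor hD).1 hv
  obtain ⟨X, hX, rfl⟩ := hΨ.exists_hor_section hhor
  have hvert := hΨ.isSection_vertPart hX.1
  have hφvert := hΨ.isSection_φ hD hvert
  refine ⟨X + fun y ↦ S.φ y (vertPart 𝓘(ℝ, E') S Ψ X y), ⟨hX.1.add_section hφvert.1, fun y ↦
    (mem_distMu_iff_φ_mem_hor hD).2 ⟨Submodule.add_mem _ (hX.2 y) (hφvert.2 y), ?_⟩⟩, ?_⟩
  · have hφ : S.φ y ((X + fun y ↦ S.φ y (vertPart 𝓘(ℝ, E') S Ψ X y)) y) =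
        hProj g 𝓘(ℝ, E') Ψ y (S.φ y (X y)) := by
      rw [Pi.add_apply, map_add, S.φ_φ, hΨ.η_vert (hvert.2 y), zero_smul, add_zero, vertPart,
        ← sub_eq_add_neg, sub_eq_iff_eq_add', vProj_add_hProj]
    rw [hφ]
    exact hProj_mem g _
  · rw [Pi.add_apply, vertPart, vProj_eq_zero g hφv, map_zero, add_zero]

end Mu

section PullbackCondition

variable [FiniteDimensional ℝ E']

theorem pullbackCondition_iff (hΨ : IsSicSubmersion h S Ψ lam D₁)
    (hU : CMDiff ∞ (T% U)) (hV : CMDiff ∞ (T% V)) (hZ : IsSection (hor g 𝓘(ℝ, E') Ψ) Z)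
    (hUZ : ∀ y, g.inner y (horPart 𝓘(ℝ, E') S Ψ U y) (Z y) = 0)
    (hVZ : ∀ y, g.inner y (horPart 𝓘(ℝ, E') S Ψ V y) (Z y) = 0) (x : M) :
    PullbackCondition h S Ψ lam U V Z x ↔
      g.inner x (nabla g (horPart 𝓘(ℝ, E') S Ψ V) Z x) (horPart 𝓘(ℝ, E') S Ψ U x) =
        g.inner x (horPart 𝓘(ℝ, E') S Ψ (oneillT g 𝓘(ℝ, E') Ψ U (vertPart 𝓘(ℝ, E') S Ψ V)) x) (Z x)
          + g.inner x (nabla g (horPart 𝓘(ℝ, E') S Ψ V) (vertPart 𝓘(ℝ, E') S Ψ U) x) (Z x)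
          - g.inner x (vertPart 𝓘(ℝ, E') S Ψ U x) (V x) * S.η x (Z x) := by
  have hpos : lam x ^ 2 ≠ 0 := (pow_pos (hΨ.lam_pos x) 2).ne'
  rw [PullbackCondition, hΨ.inner_pullbackNabla (hΨ.mdifferentiableAt_sq x)
    (hΨ.isSection_horPart hV) (hΨ.isSection_horPart hU) hZ, hVZ, g.symm x (Z x), hUZ]
  refine Iff.trans ?_ (mul_right_inj' hpos)
  simp only [hΨ.mvfderiv_sq, map_add, map_sub, map_smul, add_apply, sub_apply, smul_apply,
    smul_eq_mul, S.inner_ζ_left,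
    inner_oneillA g (hΨ.isSection_horPart hV).2 (hΨ.isSection_vertPart hU).2 (hZ.2 x)]
  constructor <;> intro heq <;> linear_combination heq

variable [T2Space M]

theorem pullbackCondition_iff_inner_nabla (hΨ : IsSicSubmersion h S Ψ lam D₁) (hS : S.IsSasakian)
    (hD : ∀ x, D₁ x = ⊥) (hU : IsSection (vert 𝓘(ℝ, E) 𝓘(ℝ, E') Ψ) U)
    (hV : IsSection (vert 𝓘(ℝ, E) 𝓘(ℝ, E') Ψ) V) (hZ : IsSection (distMu 𝓘(ℝ, E') S Ψ D₁) Z)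
    (x : M) : PullbackCondition h S Ψ lam U V Z x ↔ g.inner x (nabla g U V x) (Z x) = 0 := by
  rw [hΨ.pullbackCondition_iff hU.1 hV.1 ⟨hZ.1, fun y ↦ (hZ.2 y).1⟩
    (fun y ↦ by rw [hΨ.horPart_eq hD hU.2, inner_φ_mu hD (hU.2 y) (hZ.2 y)])
    (fun y ↦ by rw [hΨ.horPart_eq hD hV.2, inner_φ_mu hD (hV.2 y) (hZ.2 y)]),
    hΨ.vertPart_eq_zero hD hU.2, hΨ.vertPart_eq_zero hD hV.2, hΨ.horPart_eq hD hU.2,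
    hΨ.horPart_eq hD hV.2, hΨ.inner_nabla_φ hS hD hU hV hZ]
  simp only [horPart, oneillT_zero, nabla_zero, map_zero, zero_apply, zero_mul, add_zero,
    sub_zero, neg_eq_zero]

end PullbackCondition

theorem oneillT_add_nablaHat_mem_iff (hΨ : IsSicSubmersion h S Ψ lam D₁) (hS : S.IsSasakian)
    (hD : ∀ x, D₁ x = ⊥) (hU : IsSection (vert 𝓘(ℝ, E) 𝓘(ℝ, E') Ψ) U)
    (hV : IsSection (vert 𝓘(ℝ, E) 𝓘(ℝ, E') Ψ) V) (x : M) :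
    oneillT g 𝓘(ℝ, E') Ψ U (horPart 𝓘(ℝ, E') S Ψ V) x
        + nablaHat g 𝓘(ℝ, E') Ψ U (vertPart 𝓘(ℝ, E') S Ψ V) x ∈ D₁ x ↔
      S.φ x (nabla g U V x) ∈ hor g 𝓘(ℝ, E') Ψ x := by
  rw [hD, Submodule.mem_bot, hΨ.vertPart_eq_zero hD hV.2, hΨ.horPart_eq hD hV.2,
    oneillT_of_mem_vert_of_mem_hor g hU.2 (hΨ.isSection_φ hD hV).2, nablaHat, nabla_zero, map_zero,
    add_zero, hS.nabla_φ_apply hU.1 hV.1, hΨ.η_vert (hV.2 x), zero_smul, sub_zero, map_add,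
    map_smul, vProj_eq_zero g (hΨ.ζ_mem x), smul_zero, add_zero, vProj_eq_zero_iff]

section TotallyGeodesic

variable [FiniteDimensional ℝ E'] [T2Space M]

theorem D₁_eq_bot_of_totallyGeodesic (hΨ : IsSicSubmersion h S Ψ lam D₁) (hS : S.IsSasakian)
    (hT : IsVertTotallyGeodesic g 𝓘(ℝ, E') Ψ) (x : M) : D₁ x = ⊥ := by
  refine (Submodule.eq_bot_iff _).2 fun u hu ↦ ?_
  obtain ⟨U, hU, hUx⟩ := hΨ.exists_vert_section (hΨ.D₁_le x (hΨ.φ_mem_D₁ hu))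
  obtain ⟨V, hV, rfl⟩ := hΨ.exists_vert_section (hΨ.D₁_le x hu)
  have hζ := hS.inner_leviCivita_ζ (mdifferentiableAt_of_contMDiff hV.1 x)
    (fun y ↦ hΨ.η_vert (hV.2 y)) (U x)
  rw [← nabla, inner_vert_hor g (hT U V hU hV x) (hΨ.ζ_mem x), hUx] at hζ
  exact hΨ.eq_zero_of_inner_φ_self (hV.2 x) (neg_eq_zero.1 hζ.symm)

theorem D₁_eq_bot_of_pullbackCondition (hΨ : IsSicSubmersion h S Ψ lam D₁) (hS : S.IsSasakian)
    (hP : ∀ U V : Π x : M, TangentSpace 𝓘(ℝ, E) x,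
      IsSection (vert 𝓘(ℝ, E) 𝓘(ℝ, E') Ψ) U → IsSection (vert 𝓘(ℝ, E) 𝓘(ℝ, E') Ψ) V →
        ∀ x, PullbackCondition h S Ψ lam U V S.ζ x) (x : M) : D₁ x = ⊥ := by
  refine (Submodule.eq_bot_iff _).2 fun u hu ↦ ?_
  have hφu := hΨ.D₁_le x (hΨ.φ_mem_D₁ hu)
  obtain ⟨U, hU, rfl⟩ := hΨ.exists_vert_section (hΨ.D₁_le x hu)
  obtain ⟨V, hV, hVx⟩ := hΨ.exists_vert_section hφu
  have hvert := hΨ.isSection_vertPart (S := S) hU.1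
  have hD₂ := hΨ.φ_hProj_φ_mem_D₂ (hV.2 x)
  have hcond := (hΨ.pullbackCondition_iff hU.1 hV.1 hΨ.isSection_ζ hΨ.inner_horPart_ζ
    hΨ.inner_horPart_ζ x).1 (hP U V hU hV x)
  have hleft : g.inner x (nabla g (horPart 𝓘(ℝ, E') S Ψ V) S.ζ x)
      (horPart 𝓘(ℝ, E') S Ψ U x) = 0 := by
    rw [hS.nabla_ζ _ (hΨ.isSection_horPart hV.1).1, map_neg, neg_apply, neg_eq_zero]
    exact inner_vert_hor g hD₂.1 (hProj_mem g _)
  have hnabla : g.inner x (nabla g (horPart 𝓘(ℝ, E') S Ψ V) (vertPart 𝓘(ℝ, E') S Ψ U) x)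
      (S.ζ x) = 0 := by
    rw [nabla, hS.inner_leviCivita_ζ (mdifferentiableAt_of_contMDiff hvert.1 x)
      (fun y ↦ hΨ.η_vert (hvert.2 y)), S.inner_φ, neg_neg]
    exact (mem_orth g).1 hD₂.2 _ (hΨ.vProj_φ_mem_D₁ (hU.2 x))
  rw [hleft, hnabla, hΨ.inner_horPart_ζ, S.η_ζ, vertPart, hVx, vProj_eq_self g hφu] at hcond
  exact hΨ.eq_zero_of_inner_φ_self (hU.2 x) (by linarith)

theorem totallyGeodesic_iff (hΨ : IsSicSubmersion h S Ψ lam D₁) (hS : S.IsSasakian)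
    (hD : ∀ x, D₁ x = ⊥) :
    IsVertTotallyGeodesic g 𝓘(ℝ, E') Ψ ↔
      (∀ U V Z : Π x : M, TangentSpace 𝓘(ℝ, E) x,
        IsSection (vert 𝓘(ℝ, E) 𝓘(ℝ, E') Ψ) U → IsSection (vert 𝓘(ℝ, E) 𝓘(ℝ, E') Ψ) V →
        IsSection (distMu 𝓘(ℝ, E') S Ψ D₁) Z → ∀ x, PullbackCondition h S Ψ lam U V Z x)
      ∧ ∀ U V : Π x : M, TangentSpace 𝓘(ℝ, E) x,
        IsSection (vert 𝓘(ℝ, E) 𝓘(ℝ, E') Ψ) U → IsSection (vert 𝓘(ℝ, E) 𝓘(ℝ, E') Ψ) V →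
        ∀ x, oneillT g 𝓘(ℝ, E') Ψ U (horPart 𝓘(ℝ, E') S Ψ V) x
          + nablaHat g 𝓘(ℝ, E') Ψ U (vertPart 𝓘(ℝ, E') S Ψ V) x ∈ D₁ x := by
  refine ⟨fun hT ↦ ⟨fun U V Z hU hV hZ x ↦ ?_, fun U V hU hV x ↦ ?_⟩,
    fun ⟨hpull, hfiber⟩ U V hU hV x ↦ (hΨ.mem_vert_iff_inner_mu hD).2 ⟨?_, fun w hw ↦ ?_⟩⟩
  · exact (hΨ.pullbackCondition_iff_inner_nabla hS hD hU hV hZ x).2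
      (inner_vert_hor g (hT U V hU hV x) (hZ.2 x).1)
  · exact (hΨ.oneillT_add_nablaHat_mem_iff hS hD hU hV x).2
      (hΨ.φ_mem_hor hD (hT U V hU hV x))
  · exact (hΨ.oneillT_add_nablaHat_mem_iff hS hD hU hV x).1 (hfiber U V hU hV x)
  · obtain ⟨Z, hZ, rfl⟩ := hΨ.exists_mu_section hD hw
    exact (hΨ.pullbackCondition_iff_inner_nabla hS hD hU hV hZ x).1 (hpull U V Z hU hV hZ x)

end TotallyGeodesic

end IsSicSubmersion

end FundamentalEquivalence

end SicSubmersion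

end

theorem mainTheorem7
    {E : Type*} [NormedAddCommGroup E] [NormedSpace ℝ E] [FiniteDimensional ℝ E]
    {M : Type*} [TopologicalSpace M] [ChartedSpace E M] [IsManifold 𝓘(ℝ, E) ∞ M]
    [T2Space M] [SecondCountableTopology M]
    {E' : Type*} [NormedAddCommGroup E'] [NormedSpace ℝ E'] [FiniteDimensional ℝ E']
    {N : Type*} [TopologicalSpace N] [ChartedSpace E' N] [IsManifold 𝓘(ℝ, E') ∞ N]
    [T2Space N] [SecondCountableTopology N]
    (gm : ContMDiffRiemannianMetric 𝓘(ℝ, E) ∞ E (fun x : M ↦ TangentSpace 𝓘(ℝ, E) x))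
    (gn : ContMDiffRiemannianMetric 𝓘(ℝ, E') ∞ E' (fun y : N ↦ TangentSpace 𝓘(ℝ, E') y))
    (S : AlmostContactMetricStructure gm) (hS : S.IsSasakian)
    (Ψ : M → N) (lam : M → ℝ) (D₁ : Π x : M, Submodule ℝ (TangentSpace 𝓘(ℝ, E) x))
    (hΨ : IsSicSubmersion gn S Ψ lam D₁) :
    IsVertTotallyGeodesic gm 𝓘(ℝ, E') Ψ ↔
      (∀ U V Z : Π x : M, TangentSpace 𝓘(ℝ, E) x,
        IsSection (vert 𝓘(ℝ, E) 𝓘(ℝ, E') Ψ) U → IsSection (vert 𝓘(ℝ, E) 𝓘(ℝ, E') Ψ) V →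
        IsSection (distMu 𝓘(ℝ, E') S Ψ D₁) Z →
        ∀ x : M,
          gn.inner (Ψ x)
            (pullbackNabla gn Ψ (fun y ↦ mfderiv 𝓘(ℝ, E) 𝓘(ℝ, E') Ψ y (Z y)) x
              (horPart 𝓘(ℝ, E') S Ψ V x))
            (mfderiv 𝓘(ℝ, E) 𝓘(ℝ, E') Ψ x (horPart 𝓘(ℝ, E') S Ψ U x))
          = lam x ^ 2 * gm.inner x
            (horPart 𝓘(ℝ, E') S Ψ (oneillT gm 𝓘(ℝ, E') Ψ U (vertPart 𝓘(ℝ, E') S Ψ V)) x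
              + oneillA gm 𝓘(ℝ, E') Ψ (horPart 𝓘(ℝ, E') S Ψ V) (vertPart 𝓘(ℝ, E') S Ψ U) x
              + gm.inner x (horPart 𝓘(ℝ, E') S Ψ V x) (horPart 𝓘(ℝ, E') S Ψ U x)
                • grad gm (fun y ↦ Real.log (lam y)) x
              - gm.inner x (vertPart 𝓘(ℝ, E') S Ψ U x) (V x) • S.ζ x)
            (Z x))
      ∧ (∀ U V : Π x : M, TangentSpace 𝓘(ℝ, E) x,
        IsSection (vert 𝓘(ℝ, E) 𝓘(ℝ, E') Ψ) U → IsSection (vert 𝓘(ℝ, E) 𝓘(ℝ, E') Ψ) V →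
        ∀ x : M,
          oneillT gm 𝓘(ℝ, E') Ψ U (horPart 𝓘(ℝ, E') S Ψ V) x
            + nablaHat gm 𝓘(ℝ, E') Ψ U (vertPart 𝓘(ℝ, E') S Ψ V) x ∈ D₁ x) := by
  refine ⟨fun hT ↦ ?_, fun hC ↦ ?_⟩
  · exact (hΨ.totallyGeodesic_iff hS (hΨ.D₁_eq_bot_of_totallyGeodesic hS hT)).1 hT
  · exact (hΨ.totallyGeodesic_iff hS (hΨ.D₁_eq_bot_of_pullbackCondition hS
      fun U V hU hV x ↦ hC.1 U V S.ζ hU hV hΨ.isSection_mu_ζ x)).2 hC
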